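/- Let $\alpha\in(0,2)$ with $\alpha\neq 1$, let $\kappa>0$, and consider the equation $$\ddot x=-\kappa\,\frac{x}{|x|^{\alpha+2}},\qquad x\in\mathbb R^2\setminus\{0\}. \tag{1}$$ For a solution $x=re^{i\vartheta}$ of (1) (with $\mathbb R^2\cong\mathbb C$ and $\vartheta$ continuous), let $H=\frac12|\dot x|^2-\frac{\kappa}{\alpha|x|^{\alpha}}$ be its energy and $L=r^2\dot\vartheta$ its angular momentum, put $W(r;L)=\frac{L^2}{2r^2}-\frac{\kappa}{\alpha r^\alpha}$, and let $r_0(L)=(L^2/\kappa)^{1/(2-\alpha)}$ be the minimum point of $W(\cdot\,;L)$. Let $n,k$ be coprime positive integers. A solution $x:\mathbb R\to\mathbb R^2\setminus\{0\}$ of (1) is called a periodic solution of type $(n,k)$ if $L>0$, $W(r_0(L);L)<H<0$ (that is, $x$ is bounded and neither rectilinear nor circular), and its apsidal angle $\vartheta(T)-\vartheta(0)$, where $T$ is the minimal period of $r=|x|$, equals $2\pi k/n$. Then, for every $\tau>0$ and all coprime positive integers $n,k$, there exists a periodic solution of (1) of type $(n,k)$ with minimal period $\tau$ if and only if $$\frac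 kn\in\begin{cases}\left(\dfrac1{2-\alpha},\dfrac1{\sqrt{2-\alpha}}\right)&\text{if }\alpha\in(0,1),\\[2ex]\left(\dfrac1{\sqrt{2-\alpha}},\dfrac1{2-\alpha}\right)&\text{if }\alpha\in(1,2).\end{cases}$$ Moreover, such a solution is unique up to time translations and rotations: if $x$ and $y$ are periodic solutions of (1) of the same type $(n,k)$ with the same minimal period $\tau$, then there are $s,\varphi\in\mathbb R$ with $y(t)=e^{i\varphi}x(t+s)$ for all $t\in\mathbb R$. -/

import Mathlib

namespace HomKepler

/-- `x : ℝ → ℂ` (the plane is identified with `ℂ`) is a classical global solution of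
`ẍ = -κ x / |x| ^ (α + 2)` in the punctured plane. -/
structure IsSolution (α κ : ℝ) (x : ℝ → ℂ) : Prop where
  ne_zero : ∀ t, x t ≠ 0
  hasDerivAt : ∀ t, HasDerivAt x (deriv x t) t
  hasDerivAt_deriv : ∀ t, HasDerivAt (deriv x) (-(κ / ‖x t‖ ^ (α + 2)) • x t) t

/-- The potential `V(r) = κ / (α r ^ α)`; the equation reads `ẍ = V'(|x|) x / |x|`. -/
noncomputable def potential (α κ r : ℝ) : ℝ := κ / (α * r ^ α)

/-- The energy `|ẋ|² / 2 - V(|x|)` at time `t`. -/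
noncomputable def energy (α κ : ℝ) (x : ℝ → ℂ) (t : ℝ) : ℝ :=
  ‖deriv x t‖ ^ 2 / 2 - potential α κ ‖x t‖

/-- The scalar angular momentum `⟨i x, ẋ⟩ = x₁ ẋ₂ - x₂ ẋ₁` at time `t`; in polar
coordinates it is `r² ϑ̇`. -/
noncomputable def angularMomentum (x : ℝ → ℂ) (t : ℝ) : ℝ :=
  (x t).re * (deriv x t).im - (x t).im * (deriv x t).re

/-- The effective potential `W(r; L) = L² / (2 r²) - V(r)`. -/
noncomputable def effectivePotential (α κ L r : ℝ) : ℝ :=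
  L ^ 2 / (2 * r ^ 2) - potential α κ r

/-- The unique minimum point `r₀(L) = (L² / κ) ^ (1 / (2 - α))` of `W(·; L)`,
i.e. the radius of the circular orbits with angular momentum `L`. -/
noncomputable def circularRadius (α κ L : ℝ) : ℝ := (L ^ 2 / κ) ^ (1 / (2 - α))

/-- The set `Λ` of the pairs `(H, L)` of energy and (positive) angular momentum for which the
solutions are bounded, neither rectilinear nor circular: `L > 0` and
`min W(·; L) = W(r₀(L); L) < H < 0`. -/
def admissible (α κ : ℝ) : Set (ℝ × ℝ) :=
  {p | 0 < p.2 ∧ effectivePotential α κ p.2 (circularRadius α κ p.2) < p.1 ∧ p.1 < 0}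

/-- `τ` is the minimal period of `f`. -/
def IsMinimalPeriod {E : Type*} (f : ℝ → E) (τ : ℝ) : Prop :=
  IsLeast {s : ℝ | 0 < s ∧ Function.Periodic f s} τ

/-- `Θ` is the apsidal angle of `x`: the variation, over the minimal period `T` of the radial
component `r = |x|`, of the (continuously chosen) polar angle `ϑ` of `x = r e^{iϑ}`. -/
def HasApsidalAngle (x : ℝ → ℂ) (Θ : ℝ) : Prop :=
  ∃ T : ℝ, IsMinimalPeriod (fun t => ‖x t‖) T ∧
    ∃ ϑ : ℝ → ℝ, Continuous ϑ ∧
      (∀ t, x t = (‖x t‖ : ℂ) * Complex.exp (ϑ t * Complex.I)) ∧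
      ϑ T - ϑ 0 = Θ

/-- Periodic solutions of type `(n, k)` (for coprime positive integers `n`, `k`): solutions whose
energy `H` and angular momentum `L` satisfy `(H, L) ∈ Λ`, and whose apsidal angle is
`2 π k / n`. -/
structure IsOfType (α κ : ℝ) (n k : ℕ) (x : ℝ → ℂ) : Prop where
  isSolution : IsSolution α κ x
  admissible : ∃ H L : ℝ, (H, L) ∈ admissible α κ ∧
    (∀ t, energy α κ x t = H) ∧ (∀ t, angularMomentum x t = L)
  apsidalAngle : HasApsidalAngle x (2 * Real.pi * ((k : ℝ) / (n : ℝ)))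

end HomKepler

/-! Write r = R e^q and use the polar angle as independent variable, with z = dq/dϑ. Conservation of
energy and angular momentum becomes `well α q` = (1 - c²)(1 + z²). Here R is the radius of the
circular orbit with energy H, and c ∈ (0,1) is given by L² = κ(1 - c²)R^(2-α); admissible pairs (H,
L) correspond to pairs (R, c).

Let y = `amp α q` be the signed root of 1 - `well α q`. The relation is then the ellipse y² + (1 -
c²)z² = c², which a phase ψ parametrises by `orbAmp` and `orbVel` so that dϑ/dψ = `angDens α y`
depends on y alone. The apsidal angle is the integral of `angDens α (orbAmp c ψ)` over [0, 2π].
Since `orbAmp` changes sign under ψ ↦ ψ + π, it is also the integral over [0, π] of the symmetrised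
density `symDens`. On (0, π), `orbAmp` increases with c, so everything reduces to the monotonicity
of `symDens` on [0,1).

That is `strictMonoOn_symDens`: up to a constant that cancels in the symmetrisation, the derivative
of `angDens` is α - 1 times a positive multiple of a positive Taylor remainder (`rpowRemainder_pos`)
divided by (x - 1)³, with x = e^(αq), and x - 1 has the sign of y. The factor α - 1 treats both
ranges of the exponent at once. The limits of `symDens` at 0 and 1 give the limits 2π/√(2-α) (c → 0,
near-circular) and 2π/(2-α) (c → 1, near-rectilinear) of the apsidal angle, which takes exactly the
values strictly between, each once.

So the type (n, k) fixes c. By coprimality the orbit closes after exactly n radial periods, and R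
only rescales time, so τ fixes R. Uniqueness for the differential equation identifies every
admissible solution with a rotated, time-shifted `kepOrbit` (`IsSolution.eq_rotate_kepOrbit`). -/

namespace HomKepler

open Real Set Filter Topology MeasureTheory

/-! ### The logarithmic potential well and its square-root coordinate -/

/-- The logarithmic radial profile, normalised to have its maximum `1` at `0`. -/
noncomputable def well (α q : ℝ) : ℝ := (2 * exp ((2 - α) * q) - (2 - α) * exp (2 * q)) / α

/-- Minus the derivative of `well`. -/
noncomputable def wellSlope (α q : ℝ) : ℝ :=
  2 * (2 - α) / α * (exp (2 * q) - exp ((2 - α) * q))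

/-- The signed square root of `1 - well`. -/
noncomputable def amp (α q : ℝ) : ℝ :=
  if 0 ≤ q then √(1 - well α q) else -√(1 - well α q)

/-- The derivative of `amp`. -/
noncomputable def ampDeriv (α q : ℝ) : ℝ :=
  if q = 0 then √(2 - α) else wellSlope α q / (2 * amp α q)

/-- The inverse of `amp`. -/
noncomputable def invAmp (α : ℝ) : ℝ → ℝ := Function.invFun (amp α)

/-- The derivative of `invAmp` on `(-1, 1)`. -/
noncomputable def invAmpDeriv (α η : ℝ) : ℝ := (ampDeriv α (invAmp α η))⁻¹

theorem well_zero {α : ℝ} (h0 : 0 < α) : well α 0 = 1 := by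
  simp only [well, mul_zero, exp_zero]; field_simp; ring

theorem wellSlope_zero (α : ℝ) : wellSlope α 0 = 0 := by simp [wellSlope]

theorem hasDerivAt_well {α : ℝ} (h0 : 0 < α) (q : ℝ) :
    HasDerivAt (well α) (-wellSlope α q) q := by
  have h1 : HasDerivAt (fun q : ℝ => exp ((2 - α) * q)) (exp ((2 - α) * q) * ((2 - α) * 1)) q :=
    ((hasDerivAt_id q).const_mul (2 - α)).exp
  have h2 : HasDerivAt (fun q : ℝ => exp (2 * q)) (exp (2 * q) * (2 * 1)) q :=
    ((hasDerivAt_id q).const_mul 2).exp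
  refine (((h1.const_mul 2).sub (h2.const_mul (2 - α))).div_const α).congr_deriv ?_
  unfold wellSlope
  field_simp
  ring

theorem hasDerivAt_wellSlope (α q : ℝ) :
    HasDerivAt (wellSlope α)
      (2 * (2 - α) / α * (2 * exp (2 * q) - (2 - α) * exp ((2 - α) * q))) q := by
  have h1 : HasDerivAt (fun q : ℝ => exp ((2 - α) * q)) (exp ((2 - α) * q) * ((2 - α) * 1)) q :=
    ((hasDerivAt_id q).const_mul (2 - α)).exp
  have h2 : HasDerivAt (fun q : ℝ => exp (2 * q)) (exp (2 * q) * (2 * 1)) q :=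
    ((hasDerivAt_id q).const_mul 2).exp
  refine ((h2.sub h1).const_mul (2 * (2 - α) / α)).congr_deriv ?_
  ring

theorem continuous_well {α : ℝ} : Continuous (well α) := by unfold well; fun_prop

theorem continuous_wellSlope {α : ℝ} : Continuous (wellSlope α) := by unfold wellSlope; fun_prop

theorem wellSlope_pos {α q : ℝ} (h0 : 0 < α) (h2 : α < 2) (hq : 0 < q) : 0 < wellSlope α q := by
  have : exp ((2 - α) * q) < exp (2 * q) := exp_lt_exp.2 (by nlinarith)
  have h3 : 0 < 2 * (2 - α) / α := div_pos (by linarith) h0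
  exact mul_pos h3 (by linarith)

theorem wellSlope_neg {α q : ℝ} (h0 : 0 < α) (h2 : α < 2) (hq : q < 0) : wellSlope α q < 0 := by
  have : exp (2 * q) < exp ((2 - α) * q) := exp_lt_exp.2 (by nlinarith)
  have h3 : 0 < 2 * (2 - α) / α := div_pos (by linarith) h0
  exact mul_neg_of_pos_of_neg h3 (by linarith)

theorem well_lt_one {α q : ℝ} (h0 : 0 < α) (h2 : α < 2) (hq : q ≠ 0) : well α q < 1 := by
  rcases lt_or_gt_of_ne hq with h | h
  · have hm : StrictMonoOn (well α) (Iic 0) := by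
      apply strictMonoOn_of_deriv_pos (convex_Iic 0) continuous_well.continuousOn
      intro x hx
      rw [interior_Iic] at hx
      rw [(hasDerivAt_well h0 x).deriv]
      linarith [wellSlope_neg h0 h2 hx]
    simpa [well_zero h0] using hm h.le (by simp : (0:ℝ) ∈ Iic 0) h
  · have hm : StrictAntiOn (well α) (Ici 0) := by
      apply strictAntiOn_of_deriv_neg (convex_Ici 0) continuous_well.continuousOn
      intro x hx
      rw [interior_Ici] at hx
      rw [(hasDerivAt_well h0 x).deriv]
      linarith [wellSlope_pos h0 h2 hx]
    simpa [well_zero h0] using hm (by simp : (0:ℝ) ∈ Ici 0) h.le h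

theorem well_le_one {α : ℝ} (h0 : 0 < α) (h2 : α < 2) (q : ℝ) : well α q ≤ 1 := by
  rcases eq_or_ne q 0 with rfl | h
  · exact (well_zero h0).le
  · exact (well_lt_one h0 h2 h).le

theorem amp_sq {α : ℝ} (h0 : 0 < α) (h2 : α < 2) (q : ℝ) : amp α q ^ 2 = 1 - well α q := by
  have := sq_sqrt (sub_nonneg.2 (well_le_one h0 h2 q))
  unfold amp
  split_ifs <;> simpa using this

theorem amp_zero {α : ℝ} (h0 : 0 < α) : amp α 0 = 0 := by simp [amp, well_zero h0]

theorem amp_pos {α q : ℝ} (h0 : 0 < α) (h2 : α < 2) (hq : 0 < q) : 0 < amp α q := by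
  simp only [amp, hq.le, if_true]
  exact sqrt_pos.2 (sub_pos.2 (well_lt_one h0 h2 hq.ne'))

theorem amp_neg {α q : ℝ} (h0 : 0 < α) (h2 : α < 2) (hq : q < 0) : amp α q < 0 := by
  simp only [amp, not_le.2 hq, if_false]
  exact neg_neg_of_pos (sqrt_pos.2 (sub_pos.2 (well_lt_one h0 h2 hq.ne)))

theorem amp_ne_zero {α q : ℝ} (h0 : 0 < α) (h2 : α < 2) (hq : q ≠ 0) : amp α q ≠ 0 := by
  rcases lt_or_gt_of_ne hq with h | h
  · exact (amp_neg h0 h2 h).ne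
  · exact (amp_pos h0 h2 h).ne'

theorem continuous_amp {α : ℝ} (h0 : 0 < α) : Continuous (amp α) := by
  unfold amp
  refine Continuous.if_le ?_ ?_ continuous_const continuous_id ?_
  · exact (continuous_const.sub continuous_well).sqrt
  · exact (continuous_const.sub continuous_well).sqrt.neg
  · rintro q rfl; simp [well_zero h0]

theorem ampDeriv_pos {α : ℝ} (h0 : 0 < α) (h2 : α < 2) (q : ℝ) : 0 < ampDeriv α q := by
  unfold ampDeriv
  split_ifs with h
  · exact sqrt_pos.2 (by linarith)
  rcases lt_or_gt_of_ne h with h | h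
  · exact div_pos_of_neg_of_neg (wellSlope_neg h0 h2 h) (by linarith [amp_neg h0 h2 h])
  · exact div_pos (wellSlope_pos h0 h2 h) (by linarith [amp_pos h0 h2 h])

theorem two_mul_amp_mul_ampDeriv {α : ℝ} (h0 : 0 < α) (h2 : α < 2) (q : ℝ) :
    2 * amp α q * ampDeriv α q = wellSlope α q := by
  unfold ampDeriv
  split_ifs with h
  · subst h; simp [amp_zero h0, wellSlope_zero]
  · have := amp_ne_zero h0 h2 h
    field_simp

theorem hasDerivAt_amp_of_ne {α q : ℝ} (h0 : 0 < α) (h2 : α < 2) (hq : q ≠ 0) :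
    HasDerivAt (amp α) (ampDeriv α q) q := by
  have hw : 1 - well α q ≠ 0 := (sub_pos.2 (well_lt_one h0 h2 hq)).ne'
  have h1 : HasDerivAt (fun q => √(1 - well α q)) (wellSlope α q / (2 * √(1 - well α q))) q := by
    simpa using ((hasDerivAt_well h0 q).const_sub 1).sqrt hw
  rcases lt_or_gt_of_ne hq with h | h
  · have he : amp α =ᶠ[𝓝 q] fun q => -√(1 - well α q) := by
      filter_upwards [Iio_mem_nhds h] with y hy
      simp [amp, not_le.2 (show y < 0 from hy)]
    refine (h1.neg.congr_of_eventuallyEq he).congr_deriv ?_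
    rw [ampDeriv, if_neg hq, he.eq_of_nhds, mul_neg, div_neg]
  · have he : amp α =ᶠ[𝓝 q] fun q => √(1 - well α q) := by
      filter_upwards [Ioi_mem_nhds h] with y hy
      simp [amp, le_of_lt (show 0 < y from hy)]
    refine (h1.congr_of_eventuallyEq he).congr_deriv ?_
    rw [ampDeriv, if_neg hq, he.eq_of_nhds]

/-- Only 0 is delicate, where 1 - `well` has a double zero. The square of `ampDeriv` is `wellSlope`²
/ (4(1 - `well`)), which tends to 2 - α by l'Hôpital, and positivity of `ampDeriv` selects the root.
Continuity then lets `hasDerivAt_amp` carry the derivative across 0. -/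
theorem continuous_ampDeriv {α : ℝ} (h0 : 0 < α) (h2 : α < 2) : Continuous (ampDeriv α) := by
  rw [continuous_iff_continuousAt]
  intro q
  rcases eq_or_ne q 0 with rfl | hq
  · have hlim : Tendsto (fun q => wellSlope α q ^ 2 / (4 * (1 - well α q))) (𝓝[≠] 0)
        (𝓝 (2 - α)) := by
      have hne : ∀ᶠ q : ℝ in 𝓝[≠] 0, q ≠ 0 := eventually_mem_nhdsWithin
      refine HasDerivAt.lhopital_zero_nhdsNE
        (f' := fun q => 2 * wellSlope α q *
          (2 * (2 - α) / α * (2 * exp (2 * q) - (2 - α) * exp ((2 - α) * q))))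
        (g' := fun q => 4 * wellSlope α q) ?_ ?_ ?_ ?_ ?_ ?_
      · exact Eventually.of_forall fun q =>
          ((hasDerivAt_wellSlope α q).pow 2).congr_deriv (by simp)
      · exact Eventually.of_forall fun q => by
          simpa using ((hasDerivAt_well h0 q).const_sub 1).const_mul 4
      · filter_upwards [hne] with q hq
        rcases lt_or_gt_of_ne hq with h | h
        · exact mul_ne_zero four_ne_zero (wellSlope_neg h0 h2 h).ne
        · exact mul_ne_zero four_ne_zero (wellSlope_pos h0 h2 h).ne'
      · have : ContinuousAt (fun q => wellSlope α q ^ 2) 0 :=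
          (continuous_wellSlope.pow 2).continuousAt
        simpa [ContinuousAt, wellSlope_zero] using this.tendsto.mono_left nhdsWithin_le_nhds
      · have : ContinuousAt (fun q => 4 * (1 - well α q)) 0 :=
          (continuous_const.mul (continuous_const.sub continuous_well)).continuousAt
        simpa [ContinuousAt, well_zero h0] using this.tendsto.mono_left nhdsWithin_le_nhds
      · have hc : ContinuousAt (fun q : ℝ =>
            (2 - α) / α * (2 * exp (2 * q) - (2 - α) * exp ((2 - α) * q))) 0 := by fun_prop
        have hc' : Tendsto (fun q : ℝ =>
            (2 - α) / α * (2 * exp (2 * q) - (2 - α) * exp ((2 - α) * q))) (𝓝[≠] 0)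
            (𝓝 (2 - α)) := by
          convert hc.tendsto.mono_left nhdsWithin_le_nhds using 2
          simp; field_simp
        refine hc'.congr' ?_
        filter_upwards [hne] with q hq
        have : wellSlope α q ≠ 0 := by
          rcases lt_or_gt_of_ne hq with h | h
          · exact (wellSlope_neg h0 h2 h).ne
          · exact (wellSlope_pos h0 h2 h).ne'
        field_simp
        ring
    have hs := hlim.sqrt
    rw [continuousAt_iff_punctured_nhds]
    have h0' : ampDeriv α 0 = √(2 - α) := by simp [ampDeriv]
    rw [h0']
    refine hs.congr' ?_
    filter_upwards [(eventually_mem_nhdsWithin : ∀ᶠ q : ℝ in 𝓝[≠] 0, q ∈ ({0}ᶜ : Set ℝ))]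
      with q hq
    have hq : q ≠ 0 := hq
    have := amp_ne_zero h0 h2 hq
    rw [← amp_sq h0 h2, ← two_mul_amp_mul_ampDeriv h0 h2 q]
    rw [show (2 * amp α q * ampDeriv α q) ^ 2 / (4 * amp α q ^ 2) = ampDeriv α q ^ 2 by
      field_simp; ring, sqrt_sq (ampDeriv_pos h0 h2 q).le]
  · have he : ampDeriv α =ᶠ[𝓝 q] fun q => wellSlope α q / (2 * amp α q) := by
      filter_upwards [isOpen_ne.mem_nhds hq] with y hy
      have : y ≠ 0 := hy
      simp [ampDeriv, this]
    refine ContinuousAt.congr ?_ he.symm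
    exact continuous_wellSlope.continuousAt.div
      (continuous_const.mul (continuous_amp h0)).continuousAt
      (mul_ne_zero two_ne_zero (amp_ne_zero h0 h2 hq))

theorem hasDerivAt_amp {α : ℝ} (h0 : 0 < α) (h2 : α < 2) (q : ℝ) :
    HasDerivAt (amp α) (ampDeriv α q) q := by
  rcases eq_or_ne q 0 with rfl | hq
  · exact hasDerivAt_of_hasDerivAt_of_ne (fun y hy => hasDerivAt_amp_of_ne h0 h2 hy)
      (continuous_amp h0).continuousAt (continuous_ampDeriv h0 h2).continuousAt
  · exact hasDerivAt_amp_of_ne h0 h2 hq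

theorem strictMono_amp {α : ℝ} (h0 : 0 < α) (h2 : α < 2) : StrictMono (amp α) :=
  strictMono_of_deriv_pos fun q => by
    rw [(hasDerivAt_amp h0 h2 q).deriv]; exact ampDeriv_pos h0 h2 q

theorem tendsto_well_atBot {α : ℝ} (h2 : α < 2) : Tendsto (well α) atBot (𝓝 0) := by
  have h1 : Tendsto (fun q : ℝ => exp ((2 - α) * q)) atBot (𝓝 0) :=
    tendsto_exp_atBot.comp (tendsto_id.const_mul_atBot (by linarith))
  have h3 : Tendsto (fun q : ℝ => exp (2 * q)) atBot (𝓝 0) :=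
    tendsto_exp_atBot.comp (tendsto_id.const_mul_atBot (by norm_num))
  have h4 := ((h1.const_mul 2).sub (h3.const_mul (2 - α))).div_const α
  rw [mul_zero, mul_zero, sub_zero, zero_div] at h4
  exact h4

theorem tendsto_amp_atBot {α : ℝ} (h2 : α < 2) : Tendsto (amp α) atBot (𝓝 (-1)) := by
  have h1 : Tendsto (fun q => -√(1 - well α q)) atBot (𝓝 (-1)) := by
    simpa using ((tendsto_well_atBot h2).const_sub 1).sqrt.neg
  refine h1.congr' ?_
  filter_upwards [Iio_mem_atBot (0:ℝ)] with q hq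
  simp [amp, not_le.2 (show q < 0 from hq)]

/-- The positive zero of `well`. -/
noncomputable def wellZero (α : ℝ) : ℝ := log (2 / (2 - α)) / α

theorem wellZero_pos {α : ℝ} (h0 : 0 < α) (h2 : α < 2) : 0 < wellZero α :=
  div_pos (log_pos (by rw [lt_div_iff₀ (by linarith)]; linarith)) h0

theorem well_wellZero {α : ℝ} (h0 : 0 < α) (h2 : α < 2) : well α (wellZero α) = 0 := by
  have h3 : (0:ℝ) < 2 - α := by linarith
  have : exp (2 * wellZero α) = exp ((2 - α) * wellZero α) * (2 / (2 - α)) := by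
    have h4 : exp (α * wellZero α) = 2 / (2 - α) := by
      rw [wellZero, mul_div_cancel₀ _ h0.ne', exp_log (by positivity)]
    rw [← h4, ← exp_add]
    congr 1
    ring
  unfold well
  rw [this]; field_simp; ring

theorem amp_wellZero {α : ℝ} (h0 : 0 < α) (h2 : α < 2) : amp α (wellZero α) = 1 := by
  simp [amp, (wellZero_pos h0 h2).le, well_wellZero h0 h2]

/-- Intermediate values: `amp` tends to -1 at -∞ and equals 1 at the positive zero of the well.
Below, `invAmp` is a genuine inverse only on this range. -/
theorem exists_amp_eq {α η : ℝ} (h0 : 0 < α) (h2 : α < 2) (hη : η ∈ Ioc (-1) 1) :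
    ∃ q, amp α q = η := by
  obtain ⟨q₁, hq₁⟩ := ((tendsto_amp_atBot h2).eventually (gt_mem_nhds hη.1)).exists
  have := mem_range_of_exists_le_of_exists_ge (continuous_amp h0) ⟨q₁, hq₁.le⟩
    ⟨wellZero α, by rw [amp_wellZero h0 h2]; exact hη.2⟩
  exact this

theorem invAmp_amp {α : ℝ} (h0 : 0 < α) (h2 : α < 2) (q : ℝ) : invAmp α (amp α q) = q :=
  Function.leftInverse_invFun (strictMono_amp h0 h2).injective q

theorem amp_invAmp {α η : ℝ} (h0 : 0 < α) (h2 : α < 2) (hη : η ∈ Ioc (-1) 1) :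
    amp α (invAmp α η) = η := Function.invFun_eq (exists_amp_eq h0 h2 hη)

theorem invAmp_zero {α : ℝ} (h0 : 0 < α) (h2 : α < 2) : invAmp α 0 = 0 := by
  conv_lhs => rw [← amp_zero h0]
  exact invAmp_amp h0 h2 0

theorem continuousAt_invAmp {α η : ℝ} (h0 : 0 < α) (h2 : α < 2) (hη : η ∈ Ioo (-1) 1) :
    ContinuousAt (invAmp α) η := by
  have hemb := (strictMono_amp h0 h2).isEmbedding_of_ordConnected
    (isPreconnected_range (continuous_amp h0)).ordConnected
  rw [hemb.continuousAt_iff]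
  refine continuousAt_id.congr ?_
  filter_upwards [isOpen_Ioo.mem_nhds hη] with y hy
  exact (amp_invAmp h0 h2 ⟨hy.1, hy.2.le⟩).symm

theorem hasDerivAt_invAmp {α η : ℝ} (h0 : 0 < α) (h2 : α < 2) (hη : η ∈ Ioo (-1) 1) :
    HasDerivAt (invAmp α) (invAmpDeriv α η) η := by
  refine HasDerivAt.of_local_left_inverse (continuousAt_invAmp h0 h2 hη)
    (hasDerivAt_amp h0 h2 _) (ampDeriv_pos h0 h2 _).ne' ?_
  filter_upwards [isOpen_Ioo.mem_nhds hη] with y hy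
  exact amp_invAmp h0 h2 ⟨hy.1, hy.2.le⟩

theorem invAmpDeriv_pos {α : ℝ} (h0 : 0 < α) (h2 : α < 2) (η : ℝ) : 0 < invAmpDeriv α η :=
  inv_pos.2 (ampDeriv_pos h0 h2 _)

theorem continuousAt_invAmpDeriv {α η : ℝ} (h0 : 0 < α) (h2 : α < 2) (hη : η ∈ Ioo (-1) 1) :
    ContinuousAt (invAmpDeriv α) η :=
  ((continuous_ampDeriv h0 h2).continuousAt.comp (continuousAt_invAmp h0 h2 hη)).inv₀
    (ampDeriv_pos h0 h2 _).ne'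

/-- This is `amp`² = 1 - `well` differentiated; it expresses the derivative of the inverse without
square roots. -/
theorem wellSlope_mul_invAmpDeriv {α η : ℝ} (h0 : 0 < α) (h2 : α < 2) (hη : η ∈ Ioc (-1) 1) :
    wellSlope α (invAmp α η) * invAmpDeriv α η = 2 * η := by
  rw [← two_mul_amp_mul_ampDeriv h0 h2, amp_invAmp h0 h2 hη, invAmpDeriv, mul_assoc,
    mul_inv_cancel₀ (ampDeriv_pos h0 h2 _).ne', mul_one]

theorem well_invAmp {α η : ℝ} (h0 : 0 < α) (h2 : α < 2) (hη : η ∈ Ioc (-1) 1) :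
    well α (invAmp α η) = 1 - η ^ 2 := by
  have := amp_sq h0 h2 (invAmp α η)
  rw [amp_invAmp h0 h2 hη] at this
  linarith

theorem invAmp_pos {α η : ℝ} (h0 : 0 < α) (h2 : α < 2) (hη : η ∈ Ioc 0 1) : 0 < invAmp α η := by
  rw [← (strictMono_amp h0 h2).lt_iff_lt, amp_zero h0, amp_invAmp h0 h2 ⟨by linarith [hη.1], hη.2⟩]
  exact hη.1

theorem invAmp_neg {α η : ℝ} (h0 : 0 < α) (h2 : α < 2) (hη : η ∈ Ioo (-1) 0) :
    invAmp α η < 0 := by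
  rw [← (strictMono_amp h0 h2).lt_iff_lt, amp_zero h0, amp_invAmp h0 h2 ⟨hη.1, by linarith [hη.2]⟩]
  exact hη.2

/-! ### Sign of a Taylor remainder of a power -/

theorem one_sub_mul_lt_rpow_neg {x p : ℝ} (hx : 0 < x) (hx1 : x ≠ 1) (hp : 0 < p) :
    1 - p * (x - 1) < x ^ (-p) := by
  have h1 : log x < x - 1 := log_lt_sub_one_of_pos hx hx1
  have h2 := add_one_le_exp (log x * (-p))
  rw [rpow_def_of_pos hx]
  nlinarith

theorem hasDerivAt_rpow_neg_taylor {x e : ℝ} (hx : 0 < x) :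
    HasDerivAt (fun x => e * (e + 1) / 2 * (x - 1) ^ 2 - e * (x - 1) + 1 - x ^ (-e))
      (e * (x ^ (-(e + 1)) - (1 - (e + 1) * (x - 1)))) x := by
  have h1 : HasDerivAt (fun x : ℝ => x - 1) 1 x := (hasDerivAt_id x).sub_const 1
  have h2 : HasDerivAt (fun x : ℝ => x ^ (-e)) (-e * x ^ (-e - 1)) x :=
    hasDerivAt_rpow_const (Or.inl hx.ne')
  refine (((((h1.pow 2).const_mul (e * (e + 1) / 2)).sub (h1.const_mul e)).add_const 1).sub
    h2).congr_deriv ?_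
  rw [show -(e + 1) = -e - 1 by ring]
  simp
  ring

/-- The expression vanishes at 1 and, by the strict tangent bound with p = e + 1, has positive
derivative. -/
theorem rpow_neg_taylor_two_pos {x e : ℝ} (he : 0 < e) (hx : 1 < x) :
    0 < e * (e + 1) / 2 * (x - 1) ^ 2 - e * (x - 1) + 1 - x ^ (-e) := by
  have hm : StrictMonoOn
      (fun x : ℝ => e * (e + 1) / 2 * (x - 1) ^ 2 - e * (x - 1) + 1 - x ^ (-e)) (Ici 1) := by
    apply strictMonoOn_of_deriv_pos (convex_Ici 1)
    · intro y hy
      exact (hasDerivAt_rpow_neg_taylor (lt_of_lt_of_le one_pos hy)).continuousAt.continuousWithinAt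
    · intro y hy
      rw [interior_Ici] at hy
      have hy : 1 < y := hy
      rw [(hasDerivAt_rpow_neg_taylor (by linarith)).deriv]
      exact mul_pos he (sub_pos.2 (one_sub_mul_lt_rpow_neg (by linarith) hy.ne' (by linarith)))
  simpa using hm (self_mem_Ici (a := (1:ℝ))) hx.le hx

theorem rpow_neg_taylor_two_neg {x e : ℝ} (he : 0 < e) (hx0 : 0 < x) (hx : x < 1) :
    e * (e + 1) / 2 * (x - 1) ^ 2 - e * (x - 1) + 1 - x ^ (-e) < 0 := by
  have hm : StrictMonoOn
      (fun x : ℝ => e * (e + 1) / 2 * (x - 1) ^ 2 - e * (x - 1) + 1 - x ^ (-e)) (Ioc 0 1) := by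
    apply strictMonoOn_of_deriv_pos (convex_Ioc 0 1)
    · intro y hy
      exact (hasDerivAt_rpow_neg_taylor hy.1).continuousAt.continuousWithinAt
    · intro y hy
      rw [interior_Ioc] at hy
      rw [(hasDerivAt_rpow_neg_taylor hy.1).deriv]
      exact mul_pos he (sub_pos.2 (one_sub_mul_lt_rpow_neg hy.1 hy.2.ne (by linarith)))
  simpa using hm ⟨hx0, hx.le⟩ ⟨one_pos, le_rfl⟩ hx

/-- The remainder of the third order Taylor expansion at `1` of `(1 - x ^ (1 - e)) / (e - 1)`. -/
noncomputable def rpowRemainder (e x : ℝ) : ℝ :=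
  e * (e + 1) / 6 * (x - 1) ^ 3 - e / 2 * (x - 1) ^ 2 + (x - 1) - (1 - x ^ (1 - e)) / (e - 1)

theorem hasDerivAt_rpowRemainder {x e : ℝ} (he : e ≠ 1) (hx : 0 < x) :
    HasDerivAt (rpowRemainder e)
      (e * (e + 1) / 2 * (x - 1) ^ 2 - e * (x - 1) + 1 - x ^ (-e)) x := by
  have h1 : HasDerivAt (fun x : ℝ => x - 1) 1 x := (hasDerivAt_id x).sub_const 1
  have h2 : HasDerivAt (fun x : ℝ => x ^ (1 - e)) ((1 - e) * x ^ (1 - e - 1)) x :=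
    hasDerivAt_rpow_const (Or.inl hx.ne')
  refine (((((h1.pow 3).const_mul (e * (e + 1) / 6)).sub ((h1.pow 2).const_mul (e / 2))).add
    h1).sub ((h2.const_sub 1).div_const (e - 1))).congr_deriv ?_
  rw [show 1 - e - 1 = -e by ring]
  have : e - 1 ≠ 0 := sub_ne_zero.2 he
  field_simp
  simp
  ring

/-- The derivative is the second-order Taylor defect of x^(-e), negative before 1 and positive after
it, so 1 is a strict minimum with value 0. -/
theorem rpowRemainder_pos {x e : ℝ} (he : 0 < e) (he1 : e ≠ 1) (hx0 : 0 < x) (hx1 : x ≠ 1) :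
    0 < rpowRemainder e x := by
  have h1 : rpowRemainder e 1 = 0 := by simp [rpowRemainder]
  rcases lt_or_gt_of_ne hx1 with hx | hx
  · have hm : StrictAntiOn (rpowRemainder e) (Ioc 0 1) := by
      apply strictAntiOn_of_deriv_neg (convex_Ioc 0 1)
      · intro y hy
        exact (hasDerivAt_rpowRemainder he1 hy.1).continuousAt.continuousWithinAt
      · intro y hy
        rw [interior_Ioc] at hy
        rw [(hasDerivAt_rpowRemainder he1 hy.1).deriv]
        exact rpow_neg_taylor_two_neg he hy.1 hy.2
    simpa [h1] using hm ⟨hx0, hx.le⟩ ⟨one_pos, le_rfl⟩ hx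
  · have hm : StrictMonoOn (rpowRemainder e) (Ici 1) := by
      apply strictMonoOn_of_deriv_pos (convex_Ici 1)
      · intro y hy
        exact (hasDerivAt_rpowRemainder he1
          (lt_of_lt_of_le one_pos hy)).continuousAt.continuousWithinAt
      · intro y hy
        rw [interior_Ici] at hy
        have hy : 1 < y := hy
        rw [(hasDerivAt_rpowRemainder he1 (by linarith)).deriv]
        exact rpow_neg_taylor_two_pos he hy
    simpa [h1] using hm (self_mem_Ici (a := (1:ℝ))) hx.le hx

/-! ### The angular density and the monotonicity of its symmetrisation -/

/-- The density of the polar angle. -/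
noncomputable def angDens (α η : ℝ) : ℝ := (1 - η ^ 2) * invAmpDeriv α η

theorem angDens_pos {α η : ℝ} (h0 : 0 < α) (h2 : α < 2) (hη : η ∈ Ioo (-1) 1) :
    0 < angDens α η :=
  mul_pos (by nlinarith [hη.1, hη.2]) (invAmpDeriv_pos h0 h2 η)

theorem continuousAt_angDens {α η : ℝ} (h0 : 0 < α) (h2 : α < 2) (hη : η ∈ Ioo (-1) 1) :
    ContinuousAt (angDens α) η :=
  ContinuousAt.mul (by fun_prop) (continuousAt_invAmpDeriv h0 h2 hη)

theorem angDens_zero {α : ℝ} (h0 : 0 < α) (h2 : α < 2) : angDens α 0 = 1 / √(2 - α) := by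
  simp [angDens, invAmpDeriv, invAmp_zero h0 h2, ampDeriv]

theorem wellSlope_invAmp_ne_zero {α η : ℝ} (h0 : 0 < α) (h2 : α < 2) (hη : η ∈ Ioc (-1) 1)
    (hη0 : η ≠ 0) : wellSlope α (invAmp α η) ≠ 0 := by
  intro h
  have := wellSlope_mul_invAmpDeriv h0 h2 hη
  rw [h, zero_mul] at this
  exact hη0 (by linarith)

theorem angDens_eq {α η : ℝ} (h0 : 0 < α) (h2 : α < 2) (hη : η ∈ Ioc (-1) 1) (hη0 : η ≠ 0) :
    angDens α η = (1 - η ^ 2) * (2 * η) / wellSlope α (invAmp α η) := by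
  rw [← wellSlope_mul_invAmpDeriv h0 h2 hη, angDens]
  field_simp [wellSlope_invAmp_ne_zero h0 h2 hη hη0]

/-- The derivative is split into a constant and a term whose sign is known. With x = e^(αq) and e =
(2-α)/α, the Taylor remainder absorbs the only non-polynomial contribution, and the rest of the
cubic Taylor polynomial combines into the constant. -/
theorem hasDerivAt_angDens {α η : ℝ} (h0 : 0 < α) (h2 : α < 2) (h1 : α ≠ 1)
    (hη : η ∈ Ioo (-1) 1) (hη0 : η ≠ 0) :
    HasDerivAt (angDens α)
      (-(1 - α ^ 2 / (6 * (2 - α)) * (((2 - α) / α) ^ 2 - 1)) -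
        (1 - α) * (2 * α ^ 2 / (2 - α) ^ 2) *
          (rpowRemainder ((2 - α) / α) (exp (α * invAmp α η)) /
            (exp (α * invAmp α η) - 1) ^ 3)) η := by
  have hη' : η ∈ Ioc (-1) 1 := ⟨hη.1, hη.2.le⟩
  have hS := wellSlope_invAmp_ne_zero h0 h2 hη' hη0
  have hd1 : HasDerivAt (fun η : ℝ => (1 - η ^ 2) * (2 * η)) (2 - 6 * η ^ 2) η := by
    refine ((((hasDerivAt_id η).pow 2).const_sub 1).mul ((hasDerivAt_id η).const_mul 2)).congr_deriv
      ?_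
    simp; ring
  have hd2 := (hasDerivAt_wellSlope α (invAmp α η)).comp η (hasDerivAt_invAmp h0 h2 hη)
  have hev : angDens α =ᶠ[𝓝 η] fun η => (1 - η ^ 2) * (2 * η) / wellSlope α (invAmp α η) := by
    filter_upwards [isOpen_Ioo.mem_nhds hη, isOpen_ne.mem_nhds hη0] with y hy hy0
    exact angDens_eq h0 h2 ⟨hy.1, hy.2.le⟩ hy0
  refine ((hd1.div hd2 hS).congr_of_eventuallyEq hev).congr_deriv ?_
  have hQd : invAmpDeriv α η = 2 * η / wellSlope α (invAmp α η) := by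
    rw [← wellSlope_mul_invAmpDeriv h0 h2 hη']; field_simp
  have hsq : η ^ 2 = 1 - well α (invAmp α η) := by rw [well_invAmp h0 h2 hη']; ring
  simp only [Function.comp]
  rw [hQd]
  set q := invAmp α η with hq
  have hb : 0 < 2 - α := by linarith
  obtain ⟨x, hx⟩ : ∃ x, x = exp (α * q) := ⟨_, rfl⟩
  obtain ⟨B, hB⟩ : ∃ B, B = exp ((2 - α) * q) := ⟨_, rfl⟩
  have hx0 : 0 < x := hx ▸ exp_pos _
  have hB0 : 0 < B := hB ▸ exp_pos _
  have hBx : exp (2 * q) = B * x := by rw [hx, hB, ← exp_add]; congr 1; ring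
  -- The exponent (2-α)/α is the one for which the power in the remainder is x / B, so that the
  -- whole identity is rational in x and B.
  have hpow : x ^ (1 - (2 - α) / α) = x / B := by
    rw [rpow_sub hx0, rpow_one, hx, hB, ← exp_mul]
    congr 2; field_simp
  have hw : wellSlope α q = 2 * (2 - α) / α * (B * (x - 1)) := by
    rw [wellSlope, hBx, ← hB]; ring
  have hx1 : x - 1 ≠ 0 := by
    intro h
    rw [hw, h] at hS; simp at hS
  have hwell : well α q = B * (2 - (2 - α) * x) / α := by
    rw [well, hBx, ← hB]; ring
  rw [hwell] at hsq
  rw [← hx, rpowRemainder, hpow, hw, ← hB, hBx]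
  -- Only even powers of η occur, so `hsq` eliminates η completely.
  have e1 : (1 - η ^ 2) * (2 * η) *
      (2 * (2 - α) / α * (2 * (B * x) - (2 - α) * B) *
        (2 * η / (2 * (2 - α) / α * (B * (x - 1))))) =
      (1 - η ^ 2) * η ^ 2 * (2 * (2 - α) / α * (2 * (B * x) - (2 - α) * B) *
        (4 / (2 * (2 - α) / α * (B * (x - 1))))) := by ring
  rw [e1, hsq]
  have hα1 : (2 - α) / α - 1 = 2 * (1 - α) / α := by field_simp; ring
  have hα1' : 1 - α ≠ 0 := sub_ne_zero.2 h1.symm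
  rw [hα1]
  field_simp
  ring

/-- The symmetrised density of the polar angle. -/
noncomputable def symDens (α η : ℝ) : ℝ := angDens α η + angDens α (-η)

theorem continuousAt_symDens {α η : ℝ} (h0 : 0 < α) (h2 : α < 2) (hη : η ∈ Ioo (-1) 1) :
    ContinuousAt (symDens α) η := by
  have hc := continuousAt_angDens h0 h2 (η := -η) ⟨by linarith [hη.2], by linarith [hη.1]⟩
  exact (continuousAt_angDens h0 h2 hη).add (hc.comp (f := fun η : ℝ => -η) continuousAt_neg)

/-- In the derivative of `symDens` the constants at η and -η cancel. The remainders are positive,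
while (x - 1)³ is positive at η and negative at -η, so the two remaining terms reinforce each other;
the product with α - 1 contains (α - 1)² and is positive. -/
theorem strictMonoOn_symDens {α : ℝ} (h0 : 0 < α) (h2 : α < 2) (h1 : α ≠ 1) :
    StrictMonoOn (fun η => (α - 1) * symDens α η) (Ico 0 1) := by
  apply strictMonoOn_of_deriv_pos (convex_Ico 0 1)
  · intro y hy
    exact (continuousAt_const.mul (continuousAt_symDens h0 h2
      ⟨by linarith [hy.1], hy.2⟩)).continuousWithinAt
  · intro η hη
    rw [interior_Ico] at hη
    have d1 := hasDerivAt_angDens h0 h2 h1 ⟨by linarith [hη.1], hη.2⟩ hη.1.ne'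
    have d2 := hasDerivAt_angDens h0 h2 h1 (η := -η) ⟨by linarith [hη.2], by linarith [hη.1]⟩
      (neg_ne_zero.2 hη.1.ne')
    have d3 := (d1.add (d2.comp η (hasDerivAt_neg η))).const_mul (α - 1)
    have d4 : deriv (fun η => (α - 1) * symDens α η) η = _ := d3.deriv
    rw [d4]
    have hb : 0 < 2 - α := by linarith
    have he : 0 < (2 - α) / α := div_pos hb h0
    have he1 : (2 - α) / α ≠ 1 := by
      rw [Ne, div_eq_one_iff_eq h0.ne']; intro h; exact h1 (by linarith)
    have x1 : 1 < exp (α * invAmp α η) :=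
      one_lt_exp_iff.2 (mul_pos h0 (invAmp_pos h0 h2 ⟨hη.1, hη.2.le⟩))
    have x2 : exp (α * invAmp α (-η)) < 1 :=
      exp_lt_one_iff.2 (mul_neg_of_pos_of_neg h0 (invAmp_neg h0 h2 ⟨by linarith [hη.2], by linarith [hη.1]⟩))
    have r1 := rpowRemainder_pos he he1 (by linarith) x1.ne'
    have r2 := rpowRemainder_pos he he1 (exp_pos _) x2.ne
    have p1 := div_pos r1 (pow_pos (sub_pos.2 x1) 3)
    have p2 := div_neg_of_pos_of_neg r2 (Odd.pow_neg (by decide : Odd 3) (sub_neg.2 x2))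
    have hC : 0 < (1 - α) ^ 2 * (2 * α ^ 2 / (2 - α) ^ 2) :=
      mul_pos (by have := sub_ne_zero.2 h1.symm; positivity) (by positivity)
    nlinarith [mul_pos hC (sub_pos.2 (p2.trans p1))]

/-! ### Boundary values of the densities -/

theorem tendsto_angDens_one {α : ℝ} (h0 : 0 < α) (h2 : α < 2) :
    Tendsto (angDens α) (𝓝[<] 1) (𝓝 0) := by
  have hmem : ∀ᶠ η : ℝ in 𝓝[<] 1, η ∈ Ioo (1/2 : ℝ) 1 := Ioo_mem_nhdsLT (by norm_num)
  set q₀ := invAmp α (1/2) with hq₀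
  have hq₀p : 0 < q₀ := invAmp_pos h0 h2 (by norm_num)
  have hs := wellSlope_pos h0 h2 hq₀p
  -- A lower bound for the slope keeps the derivative of `invAmp` bounded near 1, so the factor 1 -
  -- η² forces the limit 0.
  have hmono : ∀ q, q₀ ≤ q → wellSlope α q₀ ≤ wellSlope α q := by
    have : MonotoneOn (wellSlope α) (Ici 0) := by
      apply monotoneOn_of_deriv_nonneg (convex_Ici 0) continuous_wellSlope.continuousOn
      · intro x _; exact (hasDerivAt_wellSlope α x).differentiableAt.differentiableWithinAt
      · intro x hx
        rw [interior_Ici] at hx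
        have hx : 0 < x := hx
        rw [(hasDerivAt_wellSlope α x).deriv]
        have h3 : 0 < 2 * (2 - α) / α := div_pos (by linarith) h0
        have : exp ((2 - α) * x) < exp (2 * x) := exp_lt_exp.2 (by nlinarith)
        have := exp_pos ((2 - α) * x)
        exact mul_nonneg h3.le (by nlinarith)
    intro q hq
    exact this hq₀p.le (hq₀p.le.trans hq) hq
  have hlim : Tendsto (fun η : ℝ => (1 - η ^ 2) * (2 / wellSlope α q₀)) (𝓝[<] 1) (𝓝 0) := by
    have : ContinuousAt (fun η : ℝ => (1 - η ^ 2) * (2 / wellSlope α q₀)) 1 := by fun_prop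
    simpa [ContinuousAt] using this.tendsto.mono_left nhdsWithin_le_nhds
  refine squeeze_zero' ?_ ?_ hlim
  · filter_upwards [hmem] with η hη
    exact (angDens_pos h0 h2 ⟨by linarith [hη.1], hη.2⟩).le
  · filter_upwards [hmem] with η hη
    have hη1 : η ∈ Ioc (-1) 1 := ⟨by linarith [hη.1], hη.2.le⟩
    have hη2 : 0 < 1 - η ^ 2 := by nlinarith [hη.1, hη.2]
    have hle : q₀ ≤ invAmp α η := by
      rw [← (strictMono_amp h0 h2).le_iff_le, amp_invAmp h0 h2 hη1, hq₀,
        amp_invAmp h0 h2 (by norm_num)]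
      exact hη.1.le
    rw [angDens_eq h0 h2 hη1 (by linarith [hη.1]), mul_div_assoc]
    refine mul_le_mul_of_nonneg_left ?_ hη2.le
    exact div_le_div₀ (by norm_num) (by linarith [hη.2]) hs (hmono _ hle)

theorem neg_one_lt_amp {α : ℝ} (h0 : 0 < α) (h2 : α < 2) (q : ℝ) : -1 < amp α q :=
  ((strictMono_amp h0 h2).monotone.le_of_tendsto (tendsto_amp_atBot h2) (q - 1)).trans_lt
    (strictMono_amp h0 h2 (by linarith))

theorem tendsto_invAmp_neg_one {α : ℝ} (h0 : 0 < α) (h2 : α < 2) :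
    Tendsto (invAmp α) (𝓝[>] (-1)) atBot := by
  rw [tendsto_atBot]
  intro M
  filter_upwards [Ioo_mem_nhdsGT (neg_one_lt_amp h0 h2 M),
    Ioo_mem_nhdsGT (show (-1:ℝ) < 1 by norm_num)] with η h h'
  rw [← (strictMono_amp h0 h2).le_iff_le, amp_invAmp h0 h2 ⟨h'.1, h'.2.le⟩]
  exact h.2.le

/-- Here 1 - η² tends to 0 while the derivative of `invAmp` blows up. After replacing 1 - η² by the
well, the factor e^((2-α)q) cancels and the quotient is continuous in x = e^(αq), which tends to 0.
-/
theorem tendsto_angDens_neg_one {α : ℝ} (h0 : 0 < α) (h2 : α < 2) :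
    Tendsto (angDens α) (𝓝[>] (-1)) (𝓝 (2 / (2 - α))) := by
  have hb : 0 < 2 - α := by linarith
  have hx : Tendsto (fun η => exp (α * invAmp α η)) (𝓝[>] (-1)) (𝓝 0) :=
    tendsto_exp_atBot.comp ((tendsto_invAmp_neg_one h0 h2).const_mul_atBot h0)
  have hη : Tendsto (fun η : ℝ => η) (𝓝[>] (-1)) (𝓝 (-1)) := nhdsWithin_le_nhds
  have hl : Tendsto (fun η : ℝ => η * (2 - (2 - α) * exp (α * invAmp α η)) /
      ((2 - α) * (exp (α * invAmp α η) - 1))) (𝓝[>] (-1)) (𝓝 (2 / (2 - α))) := by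
    have h := (hη.mul ((hx.const_mul (2 - α)).const_sub 2)).div
      ((hx.sub_const 1).const_mul (2 - α)) (mul_ne_zero hb.ne' (by norm_num))
    rw [show -1 * (2 - (2 - α) * 0) / ((2 - α) * (0 - 1)) = 2 / (2 - α) by field_simp; ring] at h
    exact h
  refine hl.congr' ?_
  filter_upwards [Ioo_mem_nhdsGT (show (-1:ℝ) < 0 by norm_num)] with η hη
  have hη1 : η ∈ Ioc (-1) 1 := ⟨hη.1, by linarith [hη.2]⟩
  have hS := wellSlope_invAmp_ne_zero h0 h2 hη1 hη.2.ne
  rw [angDens_eq h0 h2 hη1 hη.2.ne, ← well_invAmp h0 h2 hη1]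
  have hBx : exp (2 * invAmp α η) = exp ((2 - α) * invAmp α η) * exp (α * invAmp α η) := by
    rw [← exp_add]; congr 1; ring
  rw [wellSlope, hBx] at hS ⊢
  rw [well, hBx]
  have hB := exp_pos ((2 - α) * invAmp α η)
  generalize exp ((2 - α) * invAmp α η) = B at *
  generalize exp (α * invAmp α η) = x at *
  have hx1 : x - 1 ≠ 0 := by
    intro h; apply hS; rw [sub_eq_zero.1 h]; simp
  have e1 : B * x - B = B * (x - 1) := by ring
  rw [e1]
  field_simp

theorem tendsto_symDens_one {α : ℝ} (h0 : 0 < α) (h2 : α < 2) :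
    Tendsto (symDens α) (𝓝[<] 1) (𝓝 (2 / (2 - α))) := by
  have hneg : Tendsto (fun η : ℝ => -η) (𝓝[<] 1) (𝓝[>] (-1)) := tendsto_neg_nhdsLT
  have h := (tendsto_angDens_one h0 h2).add ((tendsto_angDens_neg_one h0 h2).comp hneg)
  rw [zero_add] at h
  exact h

theorem symDens_zero {α : ℝ} (h0 : 0 < α) (h2 : α < 2) : symDens α 0 = 2 / √(2 - α) := by
  rw [symDens, neg_zero, angDens_zero h0 h2]; ring

theorem lt_symDens {α η : ℝ} (h0 : 0 < α) (h2 : α < 2) (h1 : α ≠ 1) (hη : η ∈ Ioo 0 1) :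
    (α - 1) * (2 / √(2 - α)) < (α - 1) * symDens α η := by
  rw [← symDens_zero h0 h2]
  exact strictMonoOn_symDens h0 h2 h1 (by simp) ⟨hη.1.le, hη.2⟩ hη.1

theorem symDens_lt {α η : ℝ} (h0 : 0 < α) (h2 : α < 2) (h1 : α ≠ 1) (hη : η ∈ Ico 0 1) :
    (α - 1) * symDens α η < (α - 1) * (2 / (2 - α)) := by
  -- The intermediate point preserves the strict inequality, which the passage to the limit would
  -- lose.
  have hη' : η < (η + 1) / 2 := by linarith [hη.2]
  have hm : (η + 1) / 2 ∈ Ico (0:ℝ) 1 := ⟨by linarith [hη.1], by linarith [hη.2]⟩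
  refine (strictMonoOn_symDens h0 h2 h1 hη hm hη').trans_le ?_
  refine ge_of_tendsto ((tendsto_symDens_one h0 h2).const_mul (α - 1)) ?_
  filter_upwards [Ioo_mem_nhdsLT hm.2] with y hy
  exact (strictMonoOn_symDens h0 h2 h1).monotoneOn hm ⟨by linarith [hm.1, hy.1], hy.2⟩ hy.1.le

/-! ### The apsidal angle as a function of the orbit parameter -/

/-- The value of `amp` along the normalised orbit with parameter `c`. -/
noncomputable def orbAmp (c ψ : ℝ) : ℝ := c * sin ψ / √(1 - c ^ 2 * cos ψ ^ 2)

/-- The logarithmic radial velocity, with respect to the polar angle, along the normalised orbit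
with parameter `c`. -/
noncomputable def orbVel (c ψ : ℝ) : ℝ := c * cos ψ / √(1 - c ^ 2 * cos ψ ^ 2)

/-- The apsidal angle of the orbits with parameter `c`. -/
noncomputable def apsidal (α c : ℝ) : ℝ := ∫ ψ in (0:ℝ)..(2 * π), angDens α (orbAmp c ψ)

theorem orbDenom_pos {c : ℝ} (hc : c ∈ Ioo 0 1) (ψ : ℝ) : 0 < 1 - c ^ 2 * cos ψ ^ 2 := by
  have h1 := cos_sq_le_one ψ
  have h2 : c ^ 2 < 1 := by nlinarith [hc.1, hc.2]
  nlinarith [sq_nonneg c, sq_nonneg (cos ψ)]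

theorem orbAmp_sq {c : ℝ} (hc : c ∈ Ioo 0 1) (ψ : ℝ) :
    orbAmp c ψ ^ 2 = c ^ 2 * sin ψ ^ 2 / (1 - c ^ 2 * cos ψ ^ 2) := by
  rw [orbAmp, div_pow, sq_sqrt (orbDenom_pos hc ψ).le, mul_pow]

theorem orbVel_sq {c : ℝ} (hc : c ∈ Ioo 0 1) (ψ : ℝ) :
    orbVel c ψ ^ 2 = c ^ 2 * cos ψ ^ 2 / (1 - c ^ 2 * cos ψ ^ 2) := by
  rw [orbVel, div_pow, sq_sqrt (orbDenom_pos hc ψ).le, mul_pow]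

theorem one_sub_orbAmp_sq {c : ℝ} (hc : c ∈ Ioo 0 1) (ψ : ℝ) :
    1 - orbAmp c ψ ^ 2 = (1 - c ^ 2) / (1 - c ^ 2 * cos ψ ^ 2) := by
  rw [orbAmp_sq hc, eq_div_iff (orbDenom_pos hc ψ).ne', sub_mul,
    div_mul_cancel₀ _ (orbDenom_pos hc ψ).ne', sin_sq]
  ring

theorem orbAmp_mem {c : ℝ} (hc : c ∈ Ioo 0 1) (ψ : ℝ) : orbAmp c ψ ∈ Ioo (-1) 1 := by
  have h1 : 0 < 1 - orbAmp c ψ ^ 2 := by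
    rw [one_sub_orbAmp_sq hc]
    exact div_pos (by nlinarith [hc.1, hc.2]) (orbDenom_pos hc ψ)
  exact abs_lt.1 ((sq_lt_one_iff_abs_lt_one _).1 (by linarith))

theorem orbAmp_pos {c ψ : ℝ} (hc : c ∈ Ioo 0 1) (hψ : ψ ∈ Ioo 0 π) : 0 < orbAmp c ψ :=
  div_pos (mul_pos hc.1 (sin_pos_of_mem_Ioo hψ)) (sqrt_pos.2 (orbDenom_pos hc ψ))

theorem orbAmp_mem_Ico {c ψ : ℝ} (hc : c ∈ Ioo 0 1) (hψ : ψ ∈ Icc 0 π) :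
    orbAmp c ψ ∈ Ico 0 1 :=
  ⟨div_nonneg (mul_nonneg hc.1.le (sin_nonneg_of_mem_Icc hψ)) (sqrt_nonneg _),
    (orbAmp_mem hc ψ).2⟩

theorem orbAmp_add_pi (c ψ : ℝ) : orbAmp c (ψ + π) = -orbAmp c ψ := by
  simp [orbAmp, sin_add_pi, cos_add_pi, neg_div]

theorem orbAmp_add_two_pi (c ψ : ℝ) : orbAmp c (ψ + 2 * π) = orbAmp c ψ := by
  simp [orbAmp]

theorem continuous_orbAmp {c : ℝ} (hc : c ∈ Ioo 0 1) : Continuous (orbAmp c) := by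
  unfold orbAmp
  exact Continuous.div (by fun_prop) (by fun_prop) fun ψ => (sqrt_pos.2 (orbDenom_pos hc ψ)).ne'

theorem continuousAt_orbAmp_left {c : ℝ} (ψ : ℝ) (h : 1 - c ^ 2 * cos ψ ^ 2 ≠ 0)
    (h' : 0 ≤ 1 - c ^ 2 * cos ψ ^ 2) :
    ContinuousAt (fun c => orbAmp c ψ) c := by
  unfold orbAmp
  exact ContinuousAt.div (by fun_prop) (by fun_prop)
    (sqrt_pos.2 (lt_of_le_of_ne h' h.symm)).ne'

/-- The numerator increases with c and the denominator does not. -/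
theorem orbAmp_lt_orbAmp {c₁ c₂ ψ : ℝ} (h₁ : c₁ ∈ Ioo 0 1) (h₂ : c₂ ∈ Ioo 0 1) (h : c₁ < c₂)
    (hψ : ψ ∈ Ioo 0 π) : orbAmp c₁ ψ < orbAmp c₂ ψ := by
  have hs := sin_pos_of_mem_Ioo hψ
  refine div_lt_div₀ (mul_lt_mul_of_pos_right h hs) ?_ (mul_nonneg h₂.1.le hs.le)
    (sqrt_pos.2 (orbDenom_pos h₂ ψ))
  apply sqrt_le_sqrt
  have : c₁ ^ 2 ≤ c₂ ^ 2 := pow_le_pow_left₀ h₁.1.le h.le 2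
  nlinarith [sq_nonneg (cos ψ)]

theorem continuous_angDens_orbAmp {α c : ℝ} (h0 : 0 < α) (h2 : α < 2) (hc : c ∈ Ioo 0 1) :
    Continuous fun ψ => angDens α (orbAmp c ψ) :=
  continuous_iff_continuousAt.2 fun ψ =>
    (continuousAt_angDens h0 h2 (orbAmp_mem hc ψ)).comp (continuous_orbAmp hc).continuousAt

theorem continuous_symDens_orbAmp {α c : ℝ} (h0 : 0 < α) (h2 : α < 2) (hc : c ∈ Ioo 0 1) :
    Continuous fun ψ => (α - 1) * symDens α (orbAmp c ψ) :=
  continuous_const.mul <| continuous_iff_continuousAt.2 fun ψ =>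
    (continuousAt_symDens h0 h2 (orbAmp_mem hc ψ)).comp (continuous_orbAmp hc).continuousAt

/-- The half [π, 2π] is folded onto [0, π], where the amplitude is reversed. -/
theorem mul_apsidal_eq {α c : ℝ} (h0 : 0 < α) (h2 : α < 2) (hc : c ∈ Ioo 0 1) :
    (α - 1) * apsidal α c = ∫ ψ in (0:ℝ)..π, (α - 1) * symDens α (orbAmp c ψ) := by
  have hcont := continuous_angDens_orbAmp h0 h2 hc
  have h1 : ∫ ψ in π..(2 * π), angDens α (orbAmp c ψ) =
      ∫ ψ in (0:ℝ)..π, angDens α (-orbAmp c ψ) := by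
    have := intervalIntegral.integral_comp_add_right (a := 0) (b := π)
      (fun ψ => angDens α (orbAmp c ψ)) π
    simp only [orbAmp_add_pi] at this
    rw [this, zero_add, two_mul]
  have hcont' : Continuous fun ψ => angDens α (-orbAmp c ψ) := by
    have := hcont.comp (continuous_add_const π)
    simpa [Function.comp_def, orbAmp_add_pi] using this
  rw [intervalIntegral.integral_const_mul, apsidal,
    ← intervalIntegral.integral_add_adjacent_intervals (hcont.intervalIntegrable 0 π)
      (hcont.intervalIntegrable π (2 * π)), h1,
    ← intervalIntegral.integral_add (hcont.intervalIntegrable _ _) (hcont'.intervalIntegrable _ _)]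
  rfl

theorem integral_lt_of_forall_lt {f g : ℝ → ℝ} (hf : Continuous f) (hg : Continuous g)
    {a b : ℝ} (hab : a < b) (h : ∀ x ∈ Ioo a b, f x < g x) :
    ∫ x in a..b, f x < ∫ x in a..b, g x := by
  have := intervalIntegral.intervalIntegral_pos_of_pos_on
    ((hg.sub hf).intervalIntegrable (μ := volume) a b) (fun x hx => sub_pos.2 (h x hx)) hab
  simp only [Pi.sub_apply] at this
  rw [intervalIntegral.integral_sub (hg.intervalIntegrable _ _) (hf.intervalIntegrable _ _)] at this
  linarith

theorem lt_mul_apsidal {α c : ℝ} (h0 : 0 < α) (h2 : α < 2) (h1 : α ≠ 1) (hc : c ∈ Ioo 0 1) :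
    (α - 1) * (2 * π / √(2 - α)) < (α - 1) * apsidal α c := by
  rw [mul_apsidal_eq h0 h2 hc]
  refine lt_of_eq_of_lt ?_ (integral_lt_of_forall_lt
    (continuous_const (y := (α - 1) * (2 / √(2 - α)))) (continuous_symDens_orbAmp h0 h2 hc) pi_pos
    fun ψ hψ => lt_symDens h0 h2 h1 ⟨orbAmp_pos hc hψ, (orbAmp_mem hc ψ).2⟩)
  rw [intervalIntegral.integral_const, smul_eq_mul]; ring

theorem mul_apsidal_lt {α c : ℝ} (h0 : 0 < α) (h2 : α < 2) (h1 : α ≠ 1) (hc : c ∈ Ioo 0 1) :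
    (α - 1) * apsidal α c < (α - 1) * (2 * π / (2 - α)) := by
  rw [mul_apsidal_eq h0 h2 hc]
  refine lt_of_lt_of_eq (integral_lt_of_forall_lt (continuous_symDens_orbAmp h0 h2 hc)
    (continuous_const (y := (α - 1) * (2 / (2 - α)))) pi_pos
    fun ψ hψ => symDens_lt h0 h2 h1 (orbAmp_mem_Ico hc (Ioo_subset_Icc_self hψ))) ?_
  rw [intervalIntegral.integral_const, smul_eq_mul]; ring

theorem strictMonoOn_mul_apsidal {α : ℝ} (h0 : 0 < α) (h2 : α < 2) (h1 : α ≠ 1) :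
    StrictMonoOn (fun c => (α - 1) * apsidal α c) (Ioo 0 1) := by
  intro c₁ hc₁ c₂ hc₂ h
  simp only [mul_apsidal_eq h0 h2 hc₁, mul_apsidal_eq h0 h2 hc₂]
  exact integral_lt_of_forall_lt (continuous_symDens_orbAmp h0 h2 hc₁)
    (continuous_symDens_orbAmp h0 h2 hc₂) pi_pos fun ψ hψ => strictMonoOn_symDens h0 h2 h1
      (orbAmp_mem_Ico hc₁ (Ioo_subset_Icc_self hψ)) (orbAmp_mem_Ico hc₂ (Ioo_subset_Icc_self hψ))
      (orbAmp_lt_orbAmp hc₁ hc₂ h hψ)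

/-- Dominated convergence: the limits of `symDens` at 0 and 1 bound it uniformly in c and ψ. The
general filter serves interior continuity and both ends of the interval. -/
theorem tendsto_mul_apsidal {α : ℝ} (h0 : 0 < α) (h2 : α < 2) (h1 : α ≠ 1) {l : Filter ℝ}
    [l.IsCountablyGenerated] (hl : ∀ᶠ c in l, c ∈ Ioo 0 1) {g : ℝ → ℝ}
    (hg : ∀ ψ ∈ Ioo 0 π, Tendsto (fun c => symDens α (orbAmp c ψ)) l (𝓝 (g ψ))) :
    Tendsto (fun c => (α - 1) * apsidal α c) l (𝓝 (∫ ψ in (0:ℝ)..π, (α - 1) * g ψ)) := by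
  have hT : Tendsto (fun c => ∫ ψ in (0:ℝ)..π, (α - 1) * symDens α (orbAmp c ψ)) l
      (𝓝 (∫ ψ in (0:ℝ)..π, (α - 1) * g ψ)) := by
    have hne : ∀ᵐ ψ : ℝ ∂volume, ψ ≠ π := compl_mem_ae_iff.2 (measure_singleton π)
    refine intervalIntegral.tendsto_integral_filter_of_dominated_convergence
      (fun _ => |(α - 1) * (2 / √(2 - α))| + |(α - 1) * (2 / (2 - α))|) ?_ ?_ ?_ ?_
    · filter_upwards [hl] with c hc
      exact (continuous_symDens_orbAmp h0 h2 hc).aestronglyMeasurable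
    · filter_upwards [hl] with c hc
      filter_upwards [hne] with ψ hψ1 hψ
      rw [uIoc_of_le pi_pos.le] at hψ
      have hψ' : ψ ∈ Ioo 0 π := ⟨hψ.1, lt_of_le_of_ne hψ.2 hψ1⟩
      have a1 := lt_symDens h0 h2 h1 ⟨orbAmp_pos hc hψ', (orbAmp_mem hc ψ).2⟩
      have a2 := symDens_lt h0 h2 h1 (orbAmp_mem_Ico hc (Ioo_subset_Icc_self hψ'))
      rw [norm_eq_abs, abs_le]
      constructor
      · linarith [neg_abs_le ((α - 1) * (2 / √(2 - α))), abs_nonneg ((α - 1) * (2 / (2 - α)))]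
      · linarith [le_abs_self ((α - 1) * (2 / (2 - α))), abs_nonneg ((α - 1) * (2 / √(2 - α)))]
    · exact intervalIntegrable_const
    · filter_upwards [hne] with ψ hψ1 hψ
      rw [uIoc_of_le pi_pos.le] at hψ
      exact (hg ψ ⟨hψ.1, lt_of_le_of_ne hψ.2 hψ1⟩).const_mul _
  refine hT.congr' ?_
  filter_upwards [hl] with c hc
  exact (mul_apsidal_eq h0 h2 hc).symm

theorem continuousOn_mul_apsidal {α : ℝ} (h0 : 0 < α) (h2 : α < 2) (h1 : α ≠ 1) :
    ContinuousOn (fun c => (α - 1) * apsidal α c) (Ioo 0 1) := by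
  intro c hc
  apply ContinuousAt.continuousWithinAt
  have := tendsto_mul_apsidal h0 h2 h1 (l := 𝓝 c) (isOpen_Ioo.mem_nhds hc)
    (g := fun ψ => symDens α (orbAmp c ψ)) fun ψ _ =>
      ContinuousAt.comp (f := fun c => orbAmp c ψ) (continuousAt_symDens h0 h2 (orbAmp_mem hc ψ))
        (continuousAt_orbAmp_left ψ (orbDenom_pos hc ψ).ne' (orbDenom_pos hc ψ).le)
  rwa [← mul_apsidal_eq h0 h2 hc] at this

theorem tendsto_mul_apsidal_zero {α : ℝ} (h0 : 0 < α) (h2 : α < 2) (h1 : α ≠ 1) :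
    Tendsto (fun c => (α - 1) * apsidal α c) (𝓝[>] 0) (𝓝 ((α - 1) * (2 * π / √(2 - α)))) := by
  have := tendsto_mul_apsidal h0 h2 h1 (l := 𝓝[>] 0) (Ioo_mem_nhdsGT one_pos)
    (g := fun _ => symDens α 0) fun ψ _ => by
      have hA : ContinuousAt (fun c => orbAmp c ψ) 0 :=
        continuousAt_orbAmp_left ψ (by simp) (by simp)
      have hz : orbAmp 0 ψ = 0 := by simp [orbAmp]
      have hS : ContinuousAt (symDens α) (orbAmp 0 ψ) := by
        rw [hz]; exact continuousAt_symDens h0 h2 (by norm_num)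
      have := (ContinuousAt.comp (f := fun c => orbAmp c ψ) hS hA).tendsto
      simp only [Function.comp, hz] at this
      exact this.mono_left nhdsWithin_le_nhds
  convert this using 2
  rw [symDens_zero h0 h2, intervalIntegral.integral_const, smul_eq_mul]; ring

/-- For each ψ in (0, π) the amplitude tends to 1 from below as c → 1, so the integrand converges
pointwise to the left limit of `symDens`. -/
theorem tendsto_mul_apsidal_one {α : ℝ} (h0 : 0 < α) (h2 : α < 2) (h1 : α ≠ 1) :
    Tendsto (fun c => (α - 1) * apsidal α c) (𝓝[<] 1) (𝓝 ((α - 1) * (2 * π / (2 - α)))) := by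
  have := tendsto_mul_apsidal h0 h2 h1 (l := 𝓝[<] 1) (Ioo_mem_nhdsLT one_pos)
    (g := fun _ => 2 / (2 - α)) fun ψ hψ => by
      have hs := sin_pos_of_mem_Ioo hψ
      have hd : 1 - (1:ℝ) ^ 2 * cos ψ ^ 2 = sin ψ ^ 2 := by rw [sin_sq]; ring
      have hA : ContinuousAt (fun c => orbAmp c ψ) 1 :=
        continuousAt_orbAmp_left ψ (by rw [hd]; positivity) (by rw [hd]; positivity)
      have hz : orbAmp 1 ψ = 1 := by
        rw [orbAmp, hd, sqrt_sq hs.le, one_mul, div_self hs.ne']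
      refine (tendsto_symDens_one h0 h2).comp (tendsto_nhdsWithin_iff.2 ⟨?_, ?_⟩)
      · have := hA.tendsto
        rw [hz] at this
        exact this.mono_left nhdsWithin_le_nhds
      · filter_upwards [Ioo_mem_nhdsLT (one_pos (α := ℝ))] with c hc
        exact (orbAmp_mem hc ψ).2
  convert this using 2
  rw [intervalIntegral.integral_const, smul_eq_mul]; ring

theorem exists_apsidal_eq {α v : ℝ} (h0 : 0 < α) (h2 : α < 2) (h1 : α ≠ 1)
    (hv : (α - 1) * v ∈ Ioo ((α - 1) * (2 * π / √(2 - α))) ((α - 1) * (2 * π / (2 - α)))) :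
    ∃ c ∈ Ioo (0:ℝ) 1, apsidal α c = v := by
  have hz : Ioo (0:ℝ) 1 ∈ 𝓝[>] (0:ℝ) := Ioo_mem_nhdsGT one_pos
  have ho : Ioo (0:ℝ) 1 ∈ 𝓝[<] (1:ℝ) := Ioo_mem_nhdsLT one_pos
  obtain ⟨c, hc, h⟩ := isPreconnected_Ioo.intermediate_value_Ioo (le_principal_iff.2 hz)
    (le_principal_iff.2 ho) (continuousOn_mul_apsidal h0 h2 h1) (tendsto_mul_apsidal_zero h0 h2 h1)
    (tendsto_mul_apsidal_one h0 h2 h1) hv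
  exact ⟨c, hc, mul_left_cancel₀ (sub_ne_zero.2 h1) h⟩

theorem apsidal_injOn {α : ℝ} (h0 : 0 < α) (h2 : α < 2) (h1 : α ≠ 1) :
    InjOn (apsidal α) (Ioo 0 1) := fun c₁ hc₁ c₂ hc₂ h =>
  (strictMonoOn_mul_apsidal h0 h2 h1).injOn hc₁ hc₂ (by simp only [h])

/-! ### The normalised orbit, its angle and its time -/

theorem hasDerivAt_invFun {A a : ℝ → ℝ} (hA : ∀ ψ, HasDerivAt A (a ψ) ψ) (ha : ∀ ψ, 0 < a ψ)
    (hsurj : Function.Surjective A) (u : ℝ) :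
    HasDerivAt (Function.invFun A) (a (Function.invFun A u))⁻¹ u := by
  have hmono : StrictMono A := strictMono_of_deriv_pos fun ψ => by rw [(hA ψ).deriv]; exact ha ψ
  have hr := Function.rightInverse_invFun hsurj
  have hemb := hmono.isEmbedding_of_ordConnected (by rw [hsurj.range_eq]; exact ordConnected_univ)
  have hc : ContinuousAt (Function.invFun A) u := by
    rw [hemb.continuousAt_iff]
    exact continuousAt_id.congr (Eventually.of_forall fun y => (hr y).symm)
  exact HasDerivAt.of_local_left_inverse hc (hA _) (ha _).ne' (Eventually.of_forall hr)

theorem hasDerivAt_orbDenom_sqrt {c : ℝ} (hc : c ∈ Ioo 0 1) (ψ : ℝ) :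
    HasDerivAt (fun ψ => √(1 - c ^ 2 * cos ψ ^ 2))
      (c ^ 2 * cos ψ * sin ψ / √(1 - c ^ 2 * cos ψ ^ 2)) ψ := by
  have h := ((((hasDerivAt_cos ψ).pow 2).const_mul (c ^ 2)).const_sub 1).sqrt (orbDenom_pos hc ψ).ne'
  refine h.congr_deriv ?_
  have := (sqrt_pos.2 (orbDenom_pos hc ψ)).ne'
  simp
  field_simp

theorem hasDerivAt_orbAmp {c : ℝ} (hc : c ∈ Ioo 0 1) (ψ : ℝ) :
    HasDerivAt (orbAmp c) (orbVel c ψ * (1 - orbAmp c ψ ^ 2)) ψ := by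
  have hs := (sqrt_pos.2 (orbDenom_pos hc ψ)).ne'
  have hsq := sq_sqrt (orbDenom_pos hc ψ).le
  refine (((hasDerivAt_sin ψ).const_mul c).div (hasDerivAt_orbDenom_sqrt hc ψ) hs).congr_deriv ?_
  rw [one_sub_orbAmp_sq hc, orbVel]
  generalize √(1 - c ^ 2 * cos ψ ^ 2) = s at hs hsq ⊢
  rw [← hsq]
  field_simp
  rw [hsq, sin_sq]
  ring

theorem hasDerivAt_orbVel {c : ℝ} (hc : c ∈ Ioo 0 1) (ψ : ℝ) :
    HasDerivAt (orbVel c) (-orbAmp c ψ / (1 - c ^ 2 * cos ψ ^ 2)) ψ := by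
  have hs := (sqrt_pos.2 (orbDenom_pos hc ψ)).ne'
  have hsq := sq_sqrt (orbDenom_pos hc ψ).le
  refine (((hasDerivAt_cos ψ).const_mul c).div (hasDerivAt_orbDenom_sqrt hc ψ) hs).congr_deriv ?_
  rw [orbAmp]
  generalize √(1 - c ^ 2 * cos ψ ^ 2) = s at hs hsq ⊢
  rw [← hsq]
  field_simp
  rw [hsq]
  ring

/-- The logarithmic radius along the normalised orbit. -/
noncomputable def orbLog (α c ψ : ℝ) : ℝ := invAmp α (orbAmp c ψ)

/-- The density of the time. -/
noncomputable def timeDens (α c ψ : ℝ) : ℝ := exp (2 * orbLog α c ψ) * angDens α (orbAmp c ψ)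

/-- The polar angle along the normalised orbit. -/
noncomputable def orbAngle (α c ψ : ℝ) : ℝ := ∫ s in (0:ℝ)..ψ, angDens α (orbAmp c s)

/-- The time along the normalised orbit. -/
noncomputable def orbTime (α c ψ : ℝ) : ℝ := ∫ s in (0:ℝ)..ψ, timeDens α c s

/-- The radial period of the normalised orbit. -/
noncomputable def orbPeriod (α c : ℝ) : ℝ := orbTime α c (2 * π)

/-- The parameter of the normalised orbit as a function of time. -/
noncomputable def orbPhase (α c : ℝ) : ℝ → ℝ := Function.invFun (orbTime α c)

/-- The normalised orbit with parameter `c`: it has angular momentum `1` and the circular orbit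
with the same energy has radius `1`. -/
noncomputable def orbit (α c u : ℝ) : ℂ :=
  Complex.exp ((orbLog α c (orbPhase α c u) : ℂ) + (orbAngle α c (orbPhase α c u) : ℂ) * Complex.I)

section
variable {α c : ℝ}

/-- As `orbVel` stands for dq/dϑ, this identifies `angDens` as dϑ/dψ; the factor e^(2q) in
`timeDens` then comes from r² dϑ/du = 1. -/
theorem hasDerivAt_orbLog (h0 : 0 < α) (h2 : α < 2) (hc : c ∈ Ioo 0 1) (ψ : ℝ) :
    HasDerivAt (orbLog α c) (orbVel c ψ * angDens α (orbAmp c ψ)) ψ := by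
  refine ((hasDerivAt_invAmp h0 h2 (orbAmp_mem hc ψ)).comp ψ (hasDerivAt_orbAmp hc ψ)).congr_deriv ?_
  rw [angDens]; ring

theorem continuous_timeDens (h0 : 0 < α) (h2 : α < 2) (hc : c ∈ Ioo 0 1) :
    Continuous (timeDens α c) := by
  have : Continuous (orbLog α c) :=
    continuous_iff_continuousAt.2 fun ψ => (hasDerivAt_orbLog h0 h2 hc ψ).continuousAt
  exact (continuous_exp.comp (this.const_mul 2)).mul (continuous_angDens_orbAmp h0 h2 hc)

theorem timeDens_pos (h0 : 0 < α) (h2 : α < 2) (hc : c ∈ Ioo 0 1) (ψ : ℝ) : 0 < timeDens α c ψ :=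
  mul_pos (exp_pos _) (angDens_pos h0 h2 (orbAmp_mem hc ψ))

theorem periodic_timeDens : Function.Periodic (timeDens α c) (2 * π) := fun ψ => by
  simp only [timeDens, orbLog, orbAmp_add_two_pi]

theorem hasDerivAt_orbAngle (h0 : 0 < α) (h2 : α < 2) (hc : c ∈ Ioo 0 1) (ψ : ℝ) :
    HasDerivAt (orbAngle α c) (angDens α (orbAmp c ψ)) ψ :=
  (continuous_angDens_orbAmp h0 h2 hc).integral_hasStrictDerivAt 0 ψ |>.hasDerivAt

theorem hasDerivAt_orbTime (h0 : 0 < α) (h2 : α < 2) (hc : c ∈ Ioo 0 1) (ψ : ℝ) :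
    HasDerivAt (orbTime α c) (timeDens α c ψ) ψ :=
  (continuous_timeDens h0 h2 hc).integral_hasStrictDerivAt 0 ψ |>.hasDerivAt

theorem orbAngle_add_two_pi (h0 : 0 < α) (h2 : α < 2) (hc : c ∈ Ioo 0 1) (ψ : ℝ) :
    orbAngle α c (ψ + 2 * π) = orbAngle α c ψ + apsidal α c := by
  have hp : Function.Periodic (fun ψ => angDens α (orbAmp c ψ)) (2 * π) := fun ψ => by
    simp only [orbAmp_add_two_pi]
  have := hp.intervalIntegral_add_eq_add 0 ψ
    fun a b => (continuous_angDens_orbAmp h0 h2 hc).intervalIntegrable a b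
  rw [zero_add] at this
  exact this

theorem orbTime_add_two_pi (h0 : 0 < α) (h2 : α < 2) (hc : c ∈ Ioo 0 1) (ψ : ℝ) :
    orbTime α c (ψ + 2 * π) = orbTime α c ψ + orbPeriod α c := by
  have := (periodic_timeDens (α := α) (c := c)).intervalIntegral_add_eq_add 0 ψ
    fun a b => (continuous_timeDens h0 h2 hc).intervalIntegrable a b
  rw [zero_add] at this
  exact this

theorem orbPeriod_pos (h0 : 0 < α) (h2 : α < 2) (hc : c ∈ Ioo 0 1) : 0 < orbPeriod α c :=
  intervalIntegral.intervalIntegral_pos_of_pos_on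
    ((continuous_timeDens h0 h2 hc).intervalIntegrable _ _)
    (fun ψ _ => timeDens_pos h0 h2 hc ψ) two_pi_pos

theorem orbTime_surjective (h0 : 0 < α) (h2 : α < 2) (hc : c ∈ Ioo 0 1) :
    Function.Surjective (orbTime α c) := by
  have hcont : Continuous (orbTime α c) :=
    continuous_iff_continuousAt.2 fun ψ => (hasDerivAt_orbTime h0 h2 hc ψ).continuousAt
  refine hcont.surjective ?_ ?_
  · exact periodic_timeDens.tendsto_atTop_intervalIntegral_of_pos'
      ((continuous_timeDens h0 h2 hc).intervalIntegrable _ _)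
      (timeDens_pos h0 h2 hc) two_pi_pos
  · exact periodic_timeDens.tendsto_atBot_intervalIntegral_of_pos'
      ((continuous_timeDens h0 h2 hc).intervalIntegrable _ _)
      (timeDens_pos h0 h2 hc) two_pi_pos

theorem orbTime_injective (h0 : 0 < α) (h2 : α < 2) (hc : c ∈ Ioo 0 1) :
    Function.Injective (orbTime α c) :=
  (strictMono_of_deriv_pos fun ψ => by
    rw [(hasDerivAt_orbTime h0 h2 hc ψ).deriv]; exact timeDens_pos h0 h2 hc ψ).injective

theorem orbTime_orbPhase (h0 : 0 < α) (h2 : α < 2) (hc : c ∈ Ioo 0 1) (u : ℝ) :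
    orbTime α c (orbPhase α c u) = u :=
  Function.rightInverse_invFun (orbTime_surjective h0 h2 hc) u

theorem orbPhase_orbTime (h0 : 0 < α) (h2 : α < 2) (hc : c ∈ Ioo 0 1) (ψ : ℝ) :
    orbPhase α c (orbTime α c ψ) = ψ :=
  Function.leftInverse_invFun (orbTime_injective h0 h2 hc) ψ

theorem orbPhase_add_orbPeriod (h0 : 0 < α) (h2 : α < 2) (hc : c ∈ Ioo 0 1) (u : ℝ) :
    orbPhase α c (u + orbPeriod α c) = orbPhase α c u + 2 * π := by
  apply orbTime_injective h0 h2 hc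
  rw [orbTime_orbPhase h0 h2 hc, orbTime_add_two_pi h0 h2 hc, orbTime_orbPhase h0 h2 hc]

theorem hasDerivAt_orbPhase (h0 : 0 < α) (h2 : α < 2) (hc : c ∈ Ioo 0 1) (u : ℝ) :
    HasDerivAt (orbPhase α c) (timeDens α c (orbPhase α c u))⁻¹ u :=
  hasDerivAt_invFun (hasDerivAt_orbTime h0 h2 hc) (timeDens_pos h0 h2 hc)
    (orbTime_surjective h0 h2 hc) u

theorem hasDerivAt_orbLog_orbPhase (h0 : 0 < α) (h2 : α < 2) (hc : c ∈ Ioo 0 1) (u : ℝ) :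
    HasDerivAt (fun u => orbLog α c (orbPhase α c u))
      (orbVel c (orbPhase α c u) * exp (-2 * orbLog α c (orbPhase α c u))) u := by
  refine ((hasDerivAt_orbLog h0 h2 hc _).comp u (hasDerivAt_orbPhase h0 h2 hc u)).congr_deriv ?_
  have := (angDens_pos h0 h2 (orbAmp_mem hc (orbPhase α c u))).ne'
  rw [timeDens, neg_mul, exp_neg]
  field_simp

theorem hasDerivAt_orbAngle_orbPhase (h0 : 0 < α) (h2 : α < 2) (hc : c ∈ Ioo 0 1) (u : ℝ) :
    HasDerivAt (fun u => orbAngle α c (orbPhase α c u))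
      (exp (-2 * orbLog α c (orbPhase α c u))) u := by
  refine ((hasDerivAt_orbAngle h0 h2 hc _).comp u (hasDerivAt_orbPhase h0 h2 hc u)).congr_deriv ?_
  have := (angDens_pos h0 h2 (orbAmp_mem hc (orbPhase α c u))).ne'
  rw [timeDens, neg_mul, exp_neg]
  field_simp

/-- Energy conservation in logarithmic variables, that is, the ellipse y² + (1 - c²)z² = c². -/
theorem well_orbLog (h0 : 0 < α) (h2 : α < 2) (hc : c ∈ Ioo 0 1) (ψ : ℝ) :
    well α (orbLog α c ψ) = (1 - c ^ 2) * (orbVel c ψ ^ 2 + 1) := by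
  have hm := orbAmp_mem hc ψ
  have hD := (orbDenom_pos hc ψ).ne'
  rw [orbLog, well_invAmp h0 h2 ⟨hm.1, hm.2.le⟩, one_sub_orbAmp_sq hc, orbVel_sq hc]
  field_simp
  ring

theorem hasDerivAt_orbVel_orbPhase (h0 : 0 < α) (h2 : α < 2) (hc : c ∈ Ioo 0 1) (u : ℝ) :
    HasDerivAt (fun u => orbVel c (orbPhase α c u))
      (-wellSlope α (orbLog α c (orbPhase α c u)) / (2 * (1 - c ^ 2)) *
        exp (-2 * orbLog α c (orbPhase α c u))) u := by
  refine ((hasDerivAt_orbVel hc _).comp u (hasDerivAt_orbPhase h0 h2 hc u)).congr_deriv ?_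
  have hm := orbAmp_mem hc (orbPhase α c u)
  have hQ := (invAmpDeriv_pos h0 h2 (orbAmp c (orbPhase α c u))).ne'
  have hD := (orbDenom_pos hc (orbPhase α c u)).ne'
  have hc1 : 1 - c ^ 2 ≠ 0 := by nlinarith [hc.1, hc.2]
  have hw : orbAmp c (orbPhase α c u) = wellSlope α (orbLog α c (orbPhase α c u)) *
      invAmpDeriv α (orbAmp c (orbPhase α c u)) / 2 := by
    rw [orbLog, wellSlope_mul_invAmpDeriv h0 h2 ⟨hm.1, hm.2.le⟩]; ring
  rw [timeDens, angDens, one_sub_orbAmp_sq hc, neg_mul, exp_neg]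
  nth_rewrite 1 [hw]
  field_simp

theorem norm_orbit (u : ℝ) : ‖orbit α c u‖ = exp (orbLog α c (orbPhase α c u)) := by
  simp [orbit, Complex.norm_exp]

theorem hasDerivAt_orbit (h0 : 0 < α) (h2 : α < 2) (hc : c ∈ Ioo 0 1) (u : ℝ) :
    HasDerivAt (orbit α c) (orbit α c u * (((orbVel c (orbPhase α c u) : ℝ) + Complex.I) *
      (exp (-2 * orbLog α c (orbPhase α c u)) : ℝ))) u := by
  refine (((hasDerivAt_orbLog_orbPhase h0 h2 hc u).ofReal_comp.add
    ((hasDerivAt_orbAngle_orbPhase h0 h2 hc u).ofReal_comp.mul_const Complex.I)).cexp).congr_deriv ?_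
  simp only [orbit, Pi.add_apply]
  push_cast
  ring

/-- Newton's equation with force constant 1/(1 - c²). Differentiating x(z + i)e^(-2q), the imaginary
parts cancel (constant angular momentum) and the radial part reduces to the scalar identity `key`.
-/
theorem hasDerivAt_orbit_deriv (h0 : 0 < α) (h2 : α < 2) (hc : c ∈ Ioo 0 1) (u : ℝ) :
    HasDerivAt (fun u => orbit α c u * (((orbVel c (orbPhase α c u) : ℝ) + Complex.I) *
      (exp (-2 * orbLog α c (orbPhase α c u)) : ℝ)))
      (-((1 - c ^ 2)⁻¹ / ‖orbit α c u‖ ^ (α + 2)) • orbit α c u) u := by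
  have hE : HasDerivAt (fun u => exp (-2 * orbLog α c (orbPhase α c u))) _ u :=
    ((hasDerivAt_orbLog_orbPhase h0 h2 hc u).const_mul (-2)).exp
  refine ((hasDerivAt_orbit h0 h2 hc u).mul
    (((hasDerivAt_orbVel_orbPhase h0 h2 hc u).ofReal_comp.add_const Complex.I).mul
      hE.ofReal_comp)).congr_deriv ?_
  have hc1 : 1 - c ^ 2 ≠ 0 := by nlinarith [hc.1, hc.2]
  have hw := well_orbLog h0 h2 hc (orbPhase α c u)
  rw [norm_orbit]
  simp only [Pi.mul_apply]
  clear hE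
  generalize orbVel c (orbPhase α c u) = z at *
  generalize orbLog α c (orbPhase α c u) = q at *
  generalize orbit α c u = x at *
  have hB : (exp q ^ (α + 2))⁻¹ = exp (-2 * q) * exp (-2 * q) * exp ((2 - α) * q) := by
    rw [← exp_mul, ← exp_neg, ← exp_add, ← exp_add]; congr 1; ring
  -- By energy conservation z² + 1 is a multiple of the well, and in its sum with half the slope the
  -- terms in e^(2q) cancel.
  have key : -wellSlope α q / (2 * (1 - c ^ 2)) - (z ^ 2 + 1) =
      -exp ((2 - α) * q) / (1 - c ^ 2) := by
    have : z ^ 2 + 1 = well α q / (1 - c ^ 2) := by rw [hw]; field_simp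
    rw [this, wellSlope, well]
    field_simp
    ring
  rw [div_eq_mul_inv (1 - c ^ 2)⁻¹, hB, Complex.real_smul]
  have key' : -((1 - c ^ 2)⁻¹ * (exp (-2 * q) * exp (-2 * q) * exp ((2 - α) * q))) =
      (-wellSlope α q / (2 * (1 - c ^ 2)) - (z ^ 2 + 1)) * (exp (-2 * q) * exp (-2 * q)) := by
    rw [key]; ring
  rw [key']
  generalize -wellSlope α q / (2 * (1 - c ^ 2)) = w
  push_cast
  generalize (Complex.exp (-2 * (q : ℂ))) = E
  linear_combination (x * E ^ 2) * Complex.I_sq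

end

/-! ### Orbits of arbitrary size, their energy and angular momentum -/

/-- The ratio between the time scales of the normalised orbit and of the orbit of size `R`. -/
noncomputable def kepFreq (α κ c R : ℝ) : ℝ := √(κ * (1 - c ^ 2) / R ^ (α + 2))

/-- The orbit with parameter `c` whose energy is that of the circular orbit of radius `R`. -/
noncomputable def kepOrbit (α κ c R t : ℝ) : ℂ := R * orbit α c (kepFreq α κ c R * t)

theorem angularMomentum_of_deriv_eq {x : ℝ → ℂ} {t : ℝ} {w : ℂ} (h : deriv x t = x t * w) :
    angularMomentum x t = ‖x t‖ ^ 2 * w.im := by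
  rw [angularMomentum, h, ← Complex.normSq_eq_norm_sq, Complex.normSq_apply, Complex.mul_re,
    Complex.mul_im]
  ring

theorem norm_deriv_sq_of_deriv_eq {x : ℝ → ℂ} {t z m : ℝ}
    (h : deriv x t = x t * (((z : ℂ) + Complex.I) * (m : ℝ))) :
    ‖deriv x t‖ ^ 2 = ‖x t‖ ^ 2 * ((z ^ 2 + 1) * m ^ 2) := by
  rw [h, norm_mul, mul_pow, norm_mul, mul_pow, ← Complex.normSq_eq_norm_sq ((z : ℂ) + Complex.I),
    Complex.normSq_apply, Complex.norm_real, norm_eq_abs, sq_abs]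
  simp
  ring_nf
  simp

section
variable {α κ c R : ℝ}

theorem kepFreq_pos (hκ : 0 < κ) (hc : c ∈ Ioo 0 1) (hR : 0 < R) : 0 < kepFreq α κ c R := by
  have : 0 < 1 - c ^ 2 := by nlinarith [hc.1, hc.2]
  exact sqrt_pos.2 (by positivity)

theorem kepFreq_sq (hκ : 0 < κ) (hc : c ∈ Ioo 0 1) (hR : 0 < R) :
    kepFreq α κ c R ^ 2 = κ * (1 - c ^ 2) / R ^ (α + 2) := by
  have : 0 < 1 - c ^ 2 := by nlinarith [hc.1, hc.2]
  exact sq_sqrt (by positivity)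

theorem norm_kepOrbit (hR : 0 < R) (t : ℝ) :
    ‖kepOrbit α κ c R t‖ = R * exp (orbLog α c (orbPhase α c (kepFreq α κ c R * t))) := by
  rw [kepOrbit, norm_mul, norm_orbit, Complex.norm_real, norm_of_nonneg hR.le]

theorem hasDerivAt_kepOrbit (h0 : 0 < α) (h2 : α < 2) (hc : c ∈ Ioo 0 1) (t : ℝ) :
    HasDerivAt (kepOrbit α κ c R) (kepOrbit α κ c R t *
      (((orbVel c (orbPhase α c (kepFreq α κ c R * t)) : ℝ) + Complex.I) *
      (kepFreq α κ c R * exp (-2 * orbLog α c (orbPhase α c (kepFreq α κ c R * t))) : ℝ))) t := by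
  have h1 : HasDerivAt (fun t => kepFreq α κ c R * t) (kepFreq α κ c R) t := by
    simpa using (hasDerivAt_id t).const_mul (kepFreq α κ c R)
  refine (((hasDerivAt_orbit h0 h2 hc _).scomp t h1).const_mul (R : ℂ)).congr_deriv ?_
  rw [kepOrbit, Complex.real_smul]
  push_cast
  ring

theorem deriv_kepOrbit (h0 : 0 < α) (h2 : α < 2) (hc : c ∈ Ioo 0 1) (t : ℝ) :
    deriv (kepOrbit α κ c R) t = kepOrbit α κ c R t *
      (((orbVel c (orbPhase α c (kepFreq α κ c R * t)) : ℝ) + Complex.I) *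
      (kepFreq α κ c R * exp (-2 * orbLog α c (orbPhase α c (kepFreq α κ c R * t))) : ℝ)) :=
  (hasDerivAt_kepOrbit h0 h2 hc t).deriv

theorem isSolution_kepOrbit (h0 : 0 < α) (h2 : α < 2) (hκ : 0 < κ) (hc : c ∈ Ioo 0 1)
    (hR : 0 < R) : IsSolution α κ (kepOrbit α κ c R) where
  ne_zero t := by
    rw [← norm_pos_iff, norm_kepOrbit hR]; positivity
  hasDerivAt t := by
    rw [deriv_kepOrbit h0 h2 hc]; exact hasDerivAt_kepOrbit h0 h2 hc t
  hasDerivAt_deriv t := by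
    have h1 : HasDerivAt (fun t => kepFreq α κ c R * t) (kepFreq α κ c R) t := by
      simpa using (hasDerivAt_id t).const_mul (kepFreq α κ c R)
    have h3 := ((hasDerivAt_orbit_deriv h0 h2 hc _).scomp t h1).const_mul
      ((R * kepFreq α κ c R : ℝ) : ℂ)
    have he : deriv (kepOrbit α κ c R) = fun t => ((R * kepFreq α κ c R : ℝ) : ℂ) *
        ((fun u => orbit α c u * (((orbVel c (orbPhase α c u) : ℝ) + Complex.I) *
      (exp (-2 * orbLog α c (orbPhase α c u)) : ℝ))) ∘ fun t => kepFreq α κ c R * t) t := by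
      funext s
      rw [deriv_kepOrbit h0 h2 hc, kepOrbit]
      simp only [Function.comp]
      push_cast
      ring
    rw [he]
    refine h3.congr_deriv ?_
    rw [norm_kepOrbit hR, kepOrbit, norm_orbit, mul_rpow hR.le (exp_pos _).le]
    have hc1 : 1 - c ^ 2 ≠ 0 := by nlinarith [hc.1, hc.2]
    have hRp : R ^ (α + 2) ≠ 0 := (rpow_pos_of_pos hR _).ne'
    have hμ : kepFreq α κ c R ^ 2 * (1 - c ^ 2)⁻¹ = κ / R ^ (α + 2) := by
      rw [kepFreq_sq hκ hc hR]; field_simp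
    have hE : exp (orbLog α c (orbPhase α c (kepFreq α κ c R * t))) ^ (α + 2) ≠ 0 :=
      (rpow_pos_of_pos (exp_pos _) _).ne'
    rw [← div_div κ, ← hμ]
    simp only [Complex.real_smul]
    push_cast
    ring

theorem angularMomentum_kepOrbit (h0 : 0 < α) (h2 : α < 2) (hc : c ∈ Ioo 0 1)
    (hR : 0 < R) (t : ℝ) :
    angularMomentum (kepOrbit α κ c R) t = R ^ 2 * kepFreq α κ c R := by
  rw [angularMomentum_of_deriv_eq (deriv_kepOrbit h0 h2 hc t), Complex.im_mul_ofReal,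
    norm_kepOrbit hR, neg_mul, exp_neg, two_mul, exp_add]
  have := (exp_pos (orbLog α c (orbPhase α c (kepFreq α κ c R * t)))).ne'
  simp
  field_simp

theorem rpow_two_sub (hR : 0 < R) : R ^ (2 - α) = R ^ 2 / R ^ α := by
  rw [rpow_sub hR, rpow_two]

theorem rpow_add_two (hR : 0 < R) : R ^ (α + 2) = R ^ α * R ^ 2 := by
  rw [rpow_add hR, rpow_two]

/-- The energy of a motion with angular momentum `L` in terms of the logarithmic radial velocity
`z` with respect to the polar angle. -/
theorem energy_identity (h0 : 0 < α) (hc : c ∈ Ioo 0 1) (hR : 0 < R) (q : ℝ) :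
    (R ^ 2 * exp (2 * q)) * (well α q / (1 - c ^ 2)) *
      (κ * (1 - c ^ 2) / R ^ (α + 2) * exp (-2 * q) ^ 2) / 2 - potential α κ (R * exp q) =
    -(κ * (2 - α)) / (2 * α * R ^ α) := by
  have hc1 : 1 - c ^ 2 ≠ 0 := by nlinarith [hc.1, hc.2]
  have hRp : R ^ α ≠ 0 := (rpow_pos_of_pos hR _).ne'
  have h1 : exp (2 * q) * exp (-2 * q) = 1 := by rw [← exp_add]; simp
  have h3 : exp ((2 - α) * q) = exp (2 * q) / exp (α * q) := by rw [← exp_sub]; congr 1; ring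
  have h4 : exp q ^ α = exp (α * q) := by rw [← exp_mul]; congr 1; ring
  rw [potential, mul_rpow hR.le (exp_pos _).le, rpow_add_two hR, well, h3, h4]
  have h5 := (exp_pos (α * q)).ne'
  have h6 : exp (-2 * q) = (exp (2 * q))⁻¹ := by rw [neg_mul, exp_neg]
  rw [h6]
  have h7 := (exp_pos (2 * q)).ne'
  field_simp
  ring

theorem energy_kepOrbit (h0 : 0 < α) (h2 : α < 2) (hκ : 0 < κ) (hc : c ∈ Ioo 0 1)
    (hR : 0 < R) (t : ℝ) :
    energy α κ (kepOrbit α κ c R) t = -(κ * (2 - α)) / (2 * α * R ^ α) := by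
  have hc1 : 1 - c ^ 2 ≠ 0 := by nlinarith [hc.1, hc.2]
  rw [energy, norm_deriv_sq_of_deriv_eq (deriv_kepOrbit h0 h2 hc t), norm_kepOrbit hR]
  rw [← energy_identity h0 hc hR (orbLog α c (orbPhase α c (kepFreq α κ c R * t))),
    well_orbLog h0 h2 hc, mul_pow (kepFreq α κ c R), kepFreq_sq hκ hc hR, mul_div_cancel_left₀ _ hc1,
    mul_pow R, ← exp_nat_mul _ 2]
  push_cast
  ring

/-- Same form as the energy of `kepOrbit`, so the lower bound on H in `admissible` says that the
circular radius for L is smaller than R. -/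
theorem effectivePotential_circularRadius {L : ℝ} (h0 : 0 < α) (h2 : α < 2) (hκ : 0 < κ)
    (hL : 0 < L) : effectivePotential α κ L (circularRadius α κ L) =
      -(κ * (2 - α)) / (2 * α * circularRadius α κ L ^ α) := by
  have hr : 0 < circularRadius α κ L := rpow_pos_of_pos (by positivity) _
  have hpow : circularRadius α κ L ^ (2 - α) = L ^ 2 / κ := by
    rw [circularRadius, ← rpow_mul (by positivity), one_div_mul_cancel (by linarith), rpow_one]
  rw [rpow_two_sub hr] at hpow
  have hra : circularRadius α κ L ^ α ≠ 0 := (rpow_pos_of_pos hr _).ne'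
  rw [effectivePotential, potential]
  rw [div_eq_div_iff hra hκ.ne'] at hpow
  generalize circularRadius α κ L ^ α = A at *
  have : L ^ 2 = circularRadius α κ L ^ 2 * κ / A := by field_simp; linarith
  rw [this]
  field_simp
  ring

theorem mem_admissible (h0 : 0 < α) (h2 : α < 2) (hκ : 0 < κ) (hc : c ∈ Ioo 0 1) (hR : 0 < R) :
    (-(κ * (2 - α)) / (2 * α * R ^ α), R ^ 2 * kepFreq α κ c R) ∈ admissible α κ := by
  have hμ := kepFreq_pos (α := α) hκ hc hR
  have hb : 0 < 2 - α := by linarith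
  have hRa : 0 < R ^ α := rpow_pos_of_pos hR _
  have hc1 : 0 < 1 - c ^ 2 := by nlinarith [hc.1, hc.2]
  have hL : 0 < R ^ 2 * kepFreq α κ c R := by positivity
  refine ⟨hL, ?_, ?_⟩
  · simp only
    rw [effectivePotential_circularRadius h0 h2 hκ hL]
    have hlt : circularRadius α κ (R ^ 2 * kepFreq α κ c R) < R := by
      have h1 : (R ^ 2 * kepFreq α κ c R) ^ 2 / κ < R ^ (2 - α) := by
        rw [mul_pow, kepFreq_sq hκ hc hR, rpow_add_two hR, rpow_two_sub hR]
        rw [show (R ^ 2) ^ 2 * (κ * (1 - c ^ 2) / (R ^ α * R ^ 2)) / κ =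
          R ^ 2 / R ^ α * (1 - c ^ 2) by field_simp]
        have : 0 < R ^ 2 / R ^ α := by positivity
        nlinarith [mul_pos this (pow_pos hc.1 2)]
      have h3 := rpow_lt_rpow (z := 1 / (2 - α)) (by positivity) h1 (by positivity)
      rwa [← rpow_mul hR.le, mul_one_div_cancel hb.ne', rpow_one] at h3
    have hr : 0 < circularRadius α κ (R ^ 2 * kepFreq α κ c R) := rpow_pos_of_pos (by positivity) _
    have := rpow_lt_rpow hr.le hlt h0
    have hra := rpow_pos_of_pos hr α
    rw [neg_div, neg_div, neg_lt_neg_iff]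
    exact div_lt_div_of_pos_left (by positivity) (by positivity) (by nlinarith)
  · simp only
    exact div_neg_of_neg_of_pos (by nlinarith) (by positivity)

/-- The energy determines R^α, called A. With r the circular radius for L, one has L² = κ r^(2-α),
so c² = 1 - (r/R)^(2-α), which lies in (0,1) because r < R. -/
theorem exists_params {H L : ℝ} (h0 : 0 < α) (h2 : α < 2) (hκ : 0 < κ)
    (h : (H, L) ∈ admissible α κ) :
    ∃ R c : ℝ, 0 < R ∧ c ∈ Ioo 0 1 ∧ H = -(κ * (2 - α)) / (2 * α * R ^ α) ∧
      L = R ^ 2 * kepFreq α κ c R := by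
  obtain ⟨hL, hW, hH⟩ := h
  simp only at hL hW hH
  have hb : 0 < 2 - α := by linarith
  rw [effectivePotential_circularRadius h0 h2 hκ hL] at hW
  have hr : 0 < circularRadius α κ L := rpow_pos_of_pos (by positivity) _
  have hpow : circularRadius α κ L ^ (2 - α) = L ^ 2 / κ := by
    rw [circularRadius, ← rpow_mul (by positivity), one_div_mul_cancel hb.ne', rpow_one]
  set r := circularRadius α κ L with hrdef
  have hnH : 0 < -H := by linarith
  obtain ⟨A, hA⟩ : ∃ A, A = κ * (2 - α) / (2 * α * (-H)) := ⟨_, rfl⟩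
  have hA0 : 0 < A := by rw [hA]; positivity
  obtain ⟨R, hRdef⟩ : ∃ R, R = A ^ (1 / α) := ⟨_, rfl⟩
  have hR : 0 < R := by rw [hRdef]; exact rpow_pos_of_pos hA0 _
  have hRa : R ^ α = A := by rw [hRdef, ← rpow_mul hA0.le, one_div_mul_cancel h0.ne', rpow_one]
  have hHR : H = -(κ * (2 - α)) / (2 * α * R ^ α) := by
    have : H ≠ 0 := hH.ne
    rw [hRa, hA]; field_simp
  have hra : 0 < r ^ α := rpow_pos_of_pos hr _
  have hlt : r < R := by
    have h3 : r ^ α < R ^ α := by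
      rw [hHR, neg_div, neg_div, neg_lt_neg_iff, div_lt_div_iff_of_pos_left (by positivity)
        (by rw [hRa]; positivity) (by positivity)] at hW
      nlinarith
    exact (rpow_lt_rpow_iff hr.le hR.le h0).1 h3
  have hs0 : 0 < (r / R) ^ (2 - α) := by positivity
  have hs1 : (r / R) ^ (2 - α) < 1 :=
    rpow_lt_one (by positivity) ((div_lt_one hR).2 hlt) hb
  have hsq := sq_sqrt (show 0 ≤ 1 - (r / R) ^ (2 - α) by linarith)
  have hcpos : 0 < √(1 - (r / R) ^ (2 - α)) := sqrt_pos.2 (by linarith)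
  have hc : √(1 - (r / R) ^ (2 - α)) ∈ Ioo (0:ℝ) 1 := ⟨hcpos, by nlinarith⟩
  refine ⟨R, √(1 - (r / R) ^ (2 - α)), hR, hc, hHR, ?_⟩
  have hμ := kepFreq_pos (α := α) hκ hc hR
  rw [← sq_eq_sq₀ hL.le (by positivity), mul_pow, kepFreq_sq hκ hc hR, hsq, div_rpow hr.le hR.le,
    hpow, rpow_two_sub hR, rpow_add_two hR]
  rw [hRa]
  field_simp
  ring

end

/-! ### Uniqueness of solutions and reduction to the model orbits -/

theorem eq_of_initial_eq {α κ : ℝ} {x y : ℝ → ℂ} (hx : IsSolution α κ x) (hy : IsSolution α κ y)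
    {t₀ : ℝ} (h : x t₀ = y t₀) (h' : deriv x t₀ = deriv y t₀) : x = y := by
  let v : ℂ × ℂ → ℂ × ℂ := fun p => (p.2, -(κ / ‖p.1‖ ^ (α + 2)) • p.1)
  have hv : ∀ p : ℂ × ℂ, p.1 ≠ 0 → ContDiffAt ℝ 1 v p := by
    intro p hp
    have h1 : ContDiffAt ℝ 1 (fun p : ℂ × ℂ => ‖p.1‖) p := contDiffAt_fst.norm ℝ hp
    have h2 : ContDiffAt ℝ 1 (fun p : ℂ × ℂ => ‖p.1‖ ^ (α + 2)) p :=
      h1.rpow_const_of_ne (norm_ne_zero_iff.2 hp)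
    have h3 : ContDiffAt ℝ 1 (fun p : ℂ × ℂ => -(κ / ‖p.1‖ ^ (α + 2))) p :=
      (contDiffAt_const.div h2 (rpow_pos_of_pos (norm_pos_iff.2 hp) _).ne').neg
    exact contDiffAt_snd.prodMk (h3.smul contDiffAt_fst)
  have hsol : ∀ {z : ℝ → ℂ}, IsSolution α κ z →
      ∀ t, HasDerivAt (fun t => (z t, deriv z t)) (v (z t, deriv z t)) t := fun hz t =>
    (hz.hasDerivAt t).prodMk (hz.hasDerivAt_deriv t)
  have hcont : ∀ {z : ℝ → ℂ}, IsSolution α κ z → Continuous fun t => (z t, deriv z t) :=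
    fun hz => continuous_iff_continuousAt.2 fun t => (hsol hz t).continuousAt
  -- The vector field is C¹ off the origin, hence locally Lipschitz: agreement of the phase curves
  -- is an open and closed condition on time.
  have hclopen : IsClopen {t | (x t, deriv x t) = (y t, deriv y t)} := by
    refine ⟨isClosed_eq (hcont hx) (hcont hy), isOpen_iff_mem_nhds.2 fun t ht => ?_⟩
    have ht : (x t, deriv x t) = (y t, deriv y t) := ht
    obtain ⟨K, s, hs, hK⟩ := (hv (x t, deriv x t) (hx.ne_zero t)).exists_lipschitzOnWith
    have hxs : ∀ᶠ u in 𝓝 t, (x u, deriv x u) ∈ s := (hcont hx).continuousAt hs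
    have hys : ∀ᶠ u in 𝓝 t, (y u, deriv y u) ∈ s := by
      rw [ht] at hs; exact (hcont hy).continuousAt hs
    exact ODE_solution_unique_of_eventually (v := fun _ => v) (s := fun _ => s)
      (Eventually.of_forall fun _ => hK)
      (hxs.mono fun u hu => ⟨hsol hx u, hu⟩) (hys.mono fun u hu => ⟨hsol hy u, hu⟩) ht
  have huniv := hclopen.eq_univ ⟨t₀, by simp [h, h']⟩
  funext t
  have : t ∈ {t | (x t, deriv x t) = (y t, deriv y t)} := huniv ▸ mem_univ t
  exact congrArg Prod.fst this

theorem hasDerivAt_rotate {x : ℝ → ℂ} {a x' : ℂ} {s t : ℝ} (h : HasDerivAt x x' (t + s)) :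
    HasDerivAt (fun t => a * x (t + s)) (a * x') t :=
  (h.comp_add_const t s).const_mul a

theorem IsSolution.rotate {α κ : ℝ} {x : ℝ → ℂ} (hx : IsSolution α κ x) {a : ℂ} (ha : ‖a‖ = 1)
    (s : ℝ) : IsSolution α κ (fun t => a * x (t + s)) := by
  have hd : deriv (fun t => a * x (t + s)) = fun t => a * deriv x (t + s) :=
    funext fun t => (hasDerivAt_rotate (hx.hasDerivAt (t + s))).deriv
  refine ⟨fun t => ?_, fun t => ?_, fun t => ?_⟩
  · exact mul_ne_zero (norm_ne_zero_iff.1 (by rw [ha]; exact one_ne_zero)) (hx.ne_zero _)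
  · rw [hd]; exact hasDerivAt_rotate (hx.hasDerivAt (t + s))
  · rw [hd]
    refine (hasDerivAt_rotate (hx.hasDerivAt_deriv (t + s))).congr_deriv ?_
    rw [norm_mul, ha, one_mul, mul_smul_comm]

theorem exists_cos_sin_eq {a b : ℝ} (h : a ^ 2 + b ^ 2 = 1) : ∃ ψ, cos ψ = a ∧ sin ψ = b := by
  have hn : ‖(⟨a, b⟩ : ℂ)‖ = 1 := by
    rw [← sq_eq_sq₀ (norm_nonneg _) zero_le_one, ← Complex.normSq_eq_norm_sq,
      Complex.normSq_apply]
    simp only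
    linarith
  refine ⟨Complex.arg ⟨a, b⟩, ?_, ?_⟩
  · rw [Complex.cos_arg (norm_ne_zero_iff.1 (by rw [hn]; exact one_ne_zero)), hn, div_one]
  · rw [Complex.sin_arg, hn, div_one]

/-- The hypothesis says that (z, y) / (c√(z² + 1)) is a unit vector; ψ is its angle. -/
theorem exists_orbAmp_orbVel_eq {c y z : ℝ} (hc : c ∈ Ioo 0 1)
    (h : 1 - y ^ 2 = (1 - c ^ 2) * (z ^ 2 + 1)) : ∃ ψ, orbAmp c ψ = y ∧ orbVel c ψ = z := by
  have hz : 0 < z ^ 2 + 1 := by positivity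
  have hs : 0 < √(z ^ 2 + 1) := sqrt_pos.2 hz
  have hsq := sq_sqrt hz.le
  have hc0 := hc.1.ne'
  obtain ⟨ψ, hcos, hsin⟩ := exists_cos_sin_eq (a := z / (c * √(z ^ 2 + 1)))
    (b := y / (c * √(z ^ 2 + 1))) (by
      rw [div_pow, div_pow, mul_pow, hsq]
      field_simp
      linarith)
  have hD : √(1 - c ^ 2 * cos ψ ^ 2) = 1 / √(z ^ 2 + 1) := by
    rw [hcos, div_pow, mul_pow, hsq, ← sqrt_one, ← sqrt_div zero_le_one, sqrt_one]
    congr 1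
    field_simp
    ring
  refine ⟨ψ, ?_, ?_⟩
  · rw [orbAmp, hD, hsin]; field_simp
  · rw [orbVel, hD, hcos]; field_simp

/-- Radial and angular parts of the velocity: z is the quotient of the scalar product of x and ẋ by
the angular momentum. -/
theorem deriv_eq_mul {x : ℝ → ℂ} {t : ℝ} (hx : x t ≠ 0) (hL : angularMomentum x t ≠ 0) :
    ∃ z : ℝ, deriv x t =
      x t * (((z : ℂ) + Complex.I) * (angularMomentum x t / ‖x t‖ ^ 2 : ℝ)) := by
  refine ⟨((x t).re * (deriv x t).re + (x t).im * (deriv x t).im) / angularMomentum x t, ?_⟩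
  have hn : ‖x t‖ ^ 2 = (x t).re * (x t).re + (x t).im * (x t).im := by
    rw [← Complex.normSq_eq_norm_sq, Complex.normSq_apply]
  have hn0 : ‖x t‖ ^ 2 ≠ 0 := pow_ne_zero 2 (norm_ne_zero_iff.2 hx)
  have h1 : (((((x t).re * (deriv x t).re + (x t).im * (deriv x t).im) / angularMomentum x t : ℝ) :
      ℂ) + Complex.I) * (angularMomentum x t / ‖x t‖ ^ 2 : ℝ) =
      ⟨((x t).re * (deriv x t).re + (x t).im * (deriv x t).im) / ‖x t‖ ^ 2,
        angularMomentum x t / ‖x t‖ ^ 2⟩ := by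
    apply Complex.ext
    · rw [Complex.re_mul_ofReal]
      simp only [Complex.add_re, Complex.ofReal_re, Complex.I_re, add_zero]
      field_simp
    · rw [Complex.im_mul_ofReal]
      simp
  rw [h1]
  apply Complex.ext
  · rw [Complex.mul_re]
    simp only [angularMomentum]
    generalize ‖x t‖ ^ 2 = N at hn hn0 ⊢
    field_simp
    rw [hn]
    ring
  · rw [Complex.mul_im]
    simp only [angularMomentum]
    generalize ‖x t‖ ^ 2 = N at hn hn0 ⊢
    field_simp
    rw [hn]
    ring

section
variable {α κ c R : ℝ}

/-- Energy and angular momentum place the initial radius and radial velocity on the ellipse of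
parameter c. Its phase ψ gives the time shift, the quotient of positions gives the rotation, and
equal initial data force equality. -/
theorem IsSolution.eq_rotate_kepOrbit {x : ℝ → ℂ} (h0 : 0 < α) (h2 : α < 2) (hκ : 0 < κ)
    (hc : c ∈ Ioo 0 1) (hR : 0 < R) (hx : IsSolution α κ x)
    (hH : energy α κ x 0 = -(κ * (2 - α)) / (2 * α * R ^ α))
    (hL : angularMomentum x 0 = R ^ 2 * kepFreq α κ c R) :
    ∃ s φ : ℝ, ∀ t, x t = Complex.exp (φ * Complex.I) * kepOrbit α κ c R (t + s) := by
  have hμ := kepFreq_pos (α := α) hκ hc hR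
  have hr : 0 < ‖x 0‖ := norm_pos_iff.2 (hx.ne_zero 0)
  have hc1 : 0 < 1 - c ^ 2 := by nlinarith [hc.1, hc.2]
  obtain ⟨z, hz⟩ := deriv_eq_mul (hx.ne_zero 0) (by rw [hL]; positivity)
  obtain ⟨q, hq⟩ : ∃ q, ‖x 0‖ = R * exp q :=
    ⟨log (‖x 0‖ / R), by rw [exp_log (by positivity)]; field_simp⟩
  have hm : angularMomentum x 0 / ‖x 0‖ ^ 2 = kepFreq α κ c R * exp (-2 * q) := by
    rw [hL, hq, neg_mul, exp_neg, two_mul, exp_add]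
    have := (exp_pos q).ne'
    field_simp
  rw [hm] at hz
  have hwell : well α q = (1 - c ^ 2) * (z ^ 2 + 1) := by
    rw [energy, norm_deriv_sq_of_deriv_eq hz, hq, ← energy_identity h0 hc hR q, mul_pow (kepFreq α κ c R),
      kepFreq_sq hκ hc hR, mul_pow R, ← exp_nat_mul _ 2] at hH
    push_cast at hH
    have hpos : R ^ 2 * exp (2 * q) * (κ * (1 - c ^ 2) / R ^ (α + 2) * exp (-2 * q) ^ 2) ≠ 0 := by
      positivity
    have := mul_left_cancel₀ hpos (b := z ^ 2 + 1) (c := well α q / (1 - c ^ 2)) (by linarith)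
    rw [this]
    field_simp
  obtain ⟨ψ, hψ1, hψ2⟩ := exists_orbAmp_orbVel_eq hc (y := amp α q) (z := z) (by
    rw [amp_sq h0 h2, ← hwell]; ring)
  have hlog : orbLog α c ψ = q := by rw [orbLog, hψ1, invAmp_amp h0 h2]
  obtain ⟨s, hs⟩ : ∃ s, s = orbTime α c ψ / kepFreq α κ c R := ⟨_, rfl⟩
  have hphase : orbPhase α c (kepFreq α κ c R * s) = ψ := by
    rw [hs, mul_div_cancel₀ _ hμ.ne', orbPhase_orbTime h0 h2 hc]
  have hsol := isSolution_kepOrbit h0 h2 hκ hc hR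
  have hX := hsol.ne_zero s
  have hnX : ‖kepOrbit α κ c R s‖ = ‖x 0‖ := by rw [norm_kepOrbit hR, hphase, hlog, hq]
  have hnorm : ‖x 0 / kepOrbit α κ c R s‖ = 1 := by rw [norm_div, hnX, div_self hr.ne']
  have hexp : Complex.exp ((x 0 / kepOrbit α κ c R s).arg * Complex.I) =
      x 0 / kepOrbit α κ c R s := by
    have := Complex.norm_mul_exp_arg_mul_I (x 0 / kepOrbit α κ c R s)
    rwa [hnorm, Complex.ofReal_one, one_mul] at this
  refine ⟨s, (x 0 / kepOrbit α κ c R s).arg, fun t => ?_⟩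
  rw [hexp]
  refine congrFun (eq_of_initial_eq hx (hsol.rotate hnorm s) (t₀ := 0) ?_ ?_) t
  · simp only [zero_add]
    rw [div_mul_cancel₀ _ hX]
  · rw [(hasDerivAt_rotate (hsol.hasDerivAt (0 + s))).deriv, zero_add, hz,
      deriv_kepOrbit h0 h2 hc, hphase, hlog, hψ2]
    field_simp

/-! ### Periods and apsidal angle of the model orbits -/

/-- The radial period of `kepOrbit`. -/
noncomputable def kepPeriod (α κ c R : ℝ) : ℝ := orbPeriod α c / kepFreq α κ c R

theorem kepPeriod_pos (h0 : 0 < α) (h2 : α < 2) (hκ : 0 < κ) (hc : c ∈ Ioo 0 1) (hR : 0 < R) :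
    0 < kepPeriod α κ c R :=
  div_pos (orbPeriod_pos h0 h2 hc) (kepFreq_pos hκ hc hR)

theorem add_int_mul_of_add {f : ℝ → ℝ} {p a : ℝ} (h : ∀ t, f (t + p) = f t + a)
    (j : ℤ) (t : ℝ) : f (t + j * p) = f t + j * a := by
  induction j using Int.induction_on with
  | zero => simp
  | succ i ih =>
    have := h (t + i * p)
    push_cast at ih ⊢
    rw [show t + (i + 1) * p = t + i * p + p by ring, this, ih]; ring
  | pred i ih =>
    have := h (t + (-i - 1) * p)
    push_cast at ih ⊢
    rw [show t + (-i - 1) * p + p = t + -i * p by ring, ih] at this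
    linarith

theorem orbPhase_add_int_mul (h0 : 0 < α) (h2 : α < 2) (hκ : 0 < κ) (hc : c ∈ Ioo 0 1)
    (hR : 0 < R) (j : ℤ) (t : ℝ) :
    orbPhase α c (kepFreq α κ c R * (t + j * kepPeriod α κ c R)) =
      orbPhase α c (kepFreq α κ c R * t) + j * (2 * π) := by
  rw [← add_int_mul_of_add (orbPhase_add_orbPeriod h0 h2 hc), kepPeriod]
  have := (kepFreq_pos (α := α) hκ hc hR).ne'
  congr 1
  field_simp

theorem orbLog_add_int_mul (j : ℤ) (ψ : ℝ) : orbLog α c (ψ + j * (2 * π)) = orbLog α c ψ := by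
  have hp : Function.Periodic (orbAmp c) (2 * π) := orbAmp_add_two_pi c
  rw [orbLog, orbLog, hp.int_mul j ψ]

theorem norm_kepOrbit_add (h0 : 0 < α) (h2 : α < 2) (hκ : 0 < κ) (hc : c ∈ Ioo 0 1)
    (hR : 0 < R) (j : ℤ) (t : ℝ) :
    ‖kepOrbit α κ c R (t + j * kepPeriod α κ c R)‖ = ‖kepOrbit α κ c R t‖ := by
  rw [norm_kepOrbit hR, norm_kepOrbit hR, orbPhase_add_int_mul h0 h2 hκ hc hR, orbLog_add_int_mul]

theorem kepOrbit_add (h0 : 0 < α) (h2 : α < 2) (hκ : 0 < κ) (hc : c ∈ Ioo 0 1)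
    (hR : 0 < R) (j : ℤ) (t : ℝ) :
    kepOrbit α κ c R (t + j * kepPeriod α κ c R) =
      kepOrbit α κ c R t * Complex.exp ((j * apsidal α c : ℝ) * Complex.I) := by
  rw [kepOrbit, kepOrbit, orbit, orbit, orbPhase_add_int_mul h0 h2 hκ hc hR, orbLog_add_int_mul,
    add_int_mul_of_add (orbAngle_add_two_pi h0 h2 hc), mul_assoc, ← Complex.exp_add]
  push_cast
  congr 2
  ring

theorem eq_int_mul_of_periodic_norm (h0 : 0 < α) (h2 : α < 2) (hκ : 0 < κ) (hc : c ∈ Ioo 0 1)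
    (hR : 0 < R) {s : ℝ} (hs : Function.Periodic (fun t => ‖kepOrbit α κ c R t‖) s) :
    ∃ j : ℤ, s = j * kepPeriod α κ c R := by
  have hμ := kepFreq_pos (α := α) hκ hc hR
  -- The test time is the apocentre ψ = π/2: there the amplitude attains its maximum c, and it does
  -- so only where sin ψ = 1.
  have h := hs (orbTime α c (π / 2) / kepFreq α κ c R)
  simp only [norm_kepOrbit hR] at h
  have h := exp_injective (mul_left_cancel₀ hR.ne' h)
  rw [mul_add, mul_div_cancel₀ _ hμ.ne', orbPhase_orbTime h0 h2 hc] at h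
  obtain ⟨ψ, hψ⟩ : ∃ ψ, ψ = orbPhase α c (orbTime α c (π / 2) + kepFreq α κ c R * s) := ⟨_, rfl⟩
  have ht : orbTime α c ψ = orbTime α c (π / 2) + kepFreq α κ c R * s := by
    rw [hψ, orbTime_orbPhase h0 h2 hc]
  rw [← hψ, orbLog, orbLog] at h
  have h := congrArg (amp α) h
  have m1 := orbAmp_mem hc ψ
  have m2 := orbAmp_mem hc (π / 2)
  rw [amp_invAmp h0 h2 ⟨m1.1, m1.2.le⟩, amp_invAmp h0 h2 ⟨m2.1, m2.2.le⟩] at h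
  have hsin : sin ψ = 1 := by
    have hD := orbDenom_pos hc ψ
    have hsq := sq_sqrt hD.le
    have hD' := sqrt_pos.2 hD
    simp only [orbAmp, sin_pi_div_two, cos_pi_div_two] at h
    have hsin : sin ψ = √(1 - c ^ 2 * cos ψ ^ 2) := by
      have : c * sin ψ = c * √(1 - c ^ 2 * cos ψ ^ 2) := by
        rw [div_eq_iff hD'.ne'] at h
        simpa using h
      exact mul_left_cancel₀ hc.1.ne' this
    have hcos : cos ψ ^ 2 * (1 - c ^ 2) = 0 := by
      rw [← hsin, sin_sq] at hsq
      linarith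
    have hc1 : 1 - c ^ 2 ≠ 0 := by nlinarith [hc.1, hc.2]
    rw [hsin, (mul_eq_zero.1 hcos).resolve_right hc1]
    simp
  obtain ⟨j, hj⟩ := sin_eq_one_iff.1 hsin
  refine ⟨j, ?_⟩
  rw [← hj, add_int_mul_of_add (orbTime_add_two_pi h0 h2 hc)] at ht
  rw [kepPeriod]
  field_simp
  linarith

theorem isMinimalPeriod_norm_kepOrbit (h0 : 0 < α) (h2 : α < 2) (hκ : 0 < κ) (hc : c ∈ Ioo 0 1)
    (hR : 0 < R) : IsMinimalPeriod (fun t => ‖kepOrbit α κ c R t‖) (kepPeriod α κ c R) := by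
  have hT := kepPeriod_pos h0 h2 hκ hc hR
  refine ⟨⟨hT, fun t => ?_⟩, fun s hs => ?_⟩
  · simpa using norm_kepOrbit_add h0 h2 hκ hc hR 1 t
  · obtain ⟨j, rfl⟩ := eq_int_mul_of_periodic_norm h0 h2 hκ hc hR hs.2
    have : 0 < (j : ℝ) := pos_of_mul_pos_left hs.1 hT.le
    have : (1 : ℝ) ≤ j := by
      have : 0 < j := by exact_mod_cast this
      exact_mod_cast this
    nlinarith

/-- A period of the orbit is a period of its norm, hence j radial periods; it closes up iff j k / n
is an integer, which by coprimality means n ∣ j. -/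
theorem isMinimalPeriod_kepOrbit (h0 : 0 < α) (h2 : α < 2) (hκ : 0 < κ) (hc : c ∈ Ioo 0 1)
    (hR : 0 < R) {n k : ℕ} (hn : 0 < n) (hnk : Nat.Coprime n k)
    (hΘ : apsidal α c = 2 * π * (k / n)) :
    IsMinimalPeriod (kepOrbit α κ c R) (n * kepPeriod α κ c R) := by
  have hT := kepPeriod_pos h0 h2 hκ hc hR
  have hn' : (0 : ℝ) < n := by exact_mod_cast hn
  refine ⟨⟨mul_pos hn' hT, fun t => ?_⟩, fun s hs => ?_⟩
  · have := kepOrbit_add h0 h2 hκ hc hR n t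
    rw [Int.cast_natCast] at this
    rw [this, hΘ, show (n * (2 * π * (k / n)) : ℝ) = k * (2 * π) by field_simp]
    have h1 : Complex.exp ((k * (2 * π) : ℝ) * Complex.I) = 1 := by
      rw [Complex.exp_eq_one_iff]
      exact ⟨k, by push_cast; ring⟩
    rw [h1, mul_one]
  · obtain ⟨j, rfl⟩ := eq_int_mul_of_periodic_norm h0 h2 hκ hc hR
      (fun t => congrArg norm (hs.2 t))
    have hj : 0 < (j : ℝ) := pos_of_mul_pos_left hs.1 hT.le
    have hj' : 0 < j := by exact_mod_cast hj
    have h1 := kepOrbit_add h0 h2 hκ hc hR j 0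
    rw [hs.2 0] at h1
    have h3 := mul_left_cancel₀ ((isSolution_kepOrbit h0 h2 hκ hc hR).ne_zero 0)
      ((mul_one _).trans h1)
    obtain ⟨m, hm⟩ := Complex.exp_eq_one_iff.1 h3.symm
    have hm' : (j * apsidal α c : ℝ) = m * (2 * π) := by
      have h4 : ((j * apsidal α c : ℝ) : ℂ) * Complex.I = ((m * (2 * π) : ℝ) : ℂ) * Complex.I := by
        rw [hm]; push_cast; ring
      exact_mod_cast mul_right_cancel₀ Complex.I_ne_zero h4
    have hjk : (j * k : ℤ) = n * m := by
      rw [hΘ] at hm'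
      field_simp at hm'
      have : (j * k : ℝ) = n * m := by linarith
      exact_mod_cast this
    have hdvd : (n : ℤ) ∣ j :=
      (Nat.isCoprime_iff_coprime.2 hnk).dvd_of_dvd_mul_right ⟨m, hjk⟩
    have hle : (n : ℝ) ≤ j := by exact_mod_cast Int.le_of_dvd hj' hdvd
    exact mul_le_mul_of_nonneg_right hle hT.le

theorem kepOrbit_eq_norm_mul (hR : 0 < R) (t : ℝ) : kepOrbit α κ c R t =
    (‖kepOrbit α κ c R t‖ : ℂ) *
      Complex.exp (orbAngle α c (orbPhase α c (kepFreq α κ c R * t)) * Complex.I) := by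
  rw [norm_kepOrbit hR, kepOrbit, orbit, Complex.exp_add]
  push_cast
  ring

theorem continuous_orbAngle_orbPhase (h0 : 0 < α) (h2 : α < 2) (hc : c ∈ Ioo 0 1) :
    Continuous fun u => orbAngle α c (orbPhase α c u) :=
  continuous_iff_continuousAt.2 fun u => (hasDerivAt_orbAngle_orbPhase h0 h2 hc u).continuousAt

theorem orbAngle_add_kepPeriod (h0 : 0 < α) (h2 : α < 2) (hκ : 0 < κ) (hc : c ∈ Ioo 0 1)
    (hR : 0 < R) (t : ℝ) :
    orbAngle α c (orbPhase α c (kepFreq α κ c R * (t + kepPeriod α κ c R))) =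
      orbAngle α c (orbPhase α c (kepFreq α κ c R * t)) + apsidal α c := by
  have := orbPhase_add_int_mul h0 h2 hκ hc hR 1 t
  rw [Int.cast_one, one_mul, one_mul] at this
  rw [this, orbAngle_add_two_pi h0 h2 hc]

theorem hasApsidalAngle_kepOrbit (h0 : 0 < α) (h2 : α < 2) (hκ : 0 < κ) (hc : c ∈ Ioo 0 1)
    (hR : 0 < R) : HasApsidalAngle (kepOrbit α κ c R) (apsidal α c) := by
  refine ⟨_, isMinimalPeriod_norm_kepOrbit h0 h2 hκ hc hR,
    fun t => orbAngle α c (orbPhase α c (kepFreq α κ c R * t)),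
    (continuous_orbAngle_orbPhase h0 h2 hc).comp (continuous_const.mul continuous_id),
    kepOrbit_eq_norm_mul hR, ?_⟩
  have := orbAngle_add_kepPeriod h0 h2 hκ hc hR 0
  rw [zero_add] at this
  simp only [this]
  ring

end

/-! ### Invariance of the apsidal angle and classification by type -/

/-- Two continuous choices of a polar angle differ by a constant. -/
theorem sub_eq_sub_of_exp_eq {f g : ℝ → ℝ} (hf : Continuous f) (hg : Continuous g)
    (h : ∀ t, Complex.exp (f t * Complex.I) = Complex.exp (g t * Complex.I)) (s t : ℝ) :
    f s - f t = g s - g t := by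
  have h1 : ∀ t, ∃ m : ℤ, f t = g t + m * (2 * π) := fun t => by
    obtain ⟨m, hm⟩ := Complex.exp_eq_exp_iff_exists_int.1 (h t)
    refine ⟨m, ?_⟩
    have h4 : ((f t : ℝ) : ℂ) * Complex.I = ((g t + m * (2 * π) : ℝ) : ℂ) * Complex.I := by
      rw [hm]; push_cast; ring
    exact_mod_cast mul_right_cancel₀ Complex.I_ne_zero h4
  choose m hm using h1
  -- A continuous integer-valued function on the line is constant.
  have hc : Continuous m := by
    rw [Int.isClosedEmbedding_coe_real.isEmbedding.continuous_iff]
    have : (fun t => (f t - g t) / (2 * π)) = Int.cast ∘ m := by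
      funext t
      have := pi_pos.ne'
      simp only [Function.comp, hm t]
      field_simp
      ring
    rw [← this]
    fun_prop
  rw [hm s, hm t, PreconnectedSpace.constant inferInstance hc (x := s) (y := t)]
  ring

section
variable {α κ c R s φ : ℝ} {x : ℝ → ℂ}

theorem norm_eq_of_eq_rotate (hx : ∀ t, x t = Complex.exp (φ * Complex.I) * kepOrbit α κ c R (t + s))
    (t : ℝ) : ‖x t‖ = ‖kepOrbit α κ c R (t + s)‖ := by
  rw [hx, norm_mul, Complex.norm_exp_ofReal_mul_I, one_mul]

theorem periodic_comp_add_iff {E : Type*} {f : ℝ → E} {s p : ℝ} :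
    Function.Periodic (fun t => f (t + s)) p ↔ Function.Periodic f p := by
  refine ⟨fun h t => ?_, fun h t => ?_⟩
  · have := h (t - s)
    simp only at this
    rwa [sub_add_cancel, show t - s + p + s = t + p by ring] at this
  · have := h (t + s)
    simp only
    rwa [show t + p + s = t + s + p by ring]

theorem isMinimalPeriod_comp_add_iff {E : Type*} {f : ℝ → E} {s p : ℝ} :
    IsMinimalPeriod (fun t => f (t + s)) p ↔ IsMinimalPeriod f p := by
  simp only [IsMinimalPeriod, periodic_comp_add_iff]

theorem isMinimalPeriod_of_eq_rotate
    (hx : ∀ t, x t = Complex.exp (φ * Complex.I) * kepOrbit α κ c R (t + s)) {p : ℝ}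
    (h : IsMinimalPeriod x p) : IsMinimalPeriod (kepOrbit α κ c R) p := by
  rw [← isMinimalPeriod_comp_add_iff (s := s)]
  have : ∀ p, Function.Periodic x p ↔ Function.Periodic (fun t => kepOrbit α κ c R (t + s)) p := by
    intro p
    simp only [Function.Periodic, hx]
    exact forall_congr' fun t => mul_right_inj' (Complex.exp_ne_zero _)
  simpa only [IsMinimalPeriod, this] using h

/-- Any continuous angle differs by a constant from that of the model orbit, whose increment over
one radial period does not depend on the starting time. -/
theorem apsidalAngle_eq (h0 : 0 < α) (h2 : α < 2) (hκ : 0 < κ) (hc : c ∈ Ioo 0 1) (hR : 0 < R)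
    (hx : ∀ t, x t = Complex.exp (φ * Complex.I) * kepOrbit α κ c R (t + s)) {Θ : ℝ}
    (h : HasApsidalAngle x Θ) : Θ = apsidal α c := by
  obtain ⟨T, hT, ϑ, hϑ, hxϑ, rfl⟩ := h
  have hT' : T = kepPeriod α κ c R := by
    refine IsLeast.unique ?_ (isMinimalPeriod_norm_kepOrbit h0 h2 hκ hc hR)
    simp only [norm_eq_of_eq_rotate hx] at hT
    exact isMinimalPeriod_comp_add_iff.1 hT
  rw [sub_eq_sub_of_exp_eq hϑ
    (g := fun t => φ + orbAngle α c (orbPhase α c (kepFreq α κ c R * (t + s))))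
    (continuous_const.add ((continuous_orbAngle_orbPhase h0 h2 hc).comp (by fun_prop))) ?_ T 0]
  · rw [hT', show kepPeriod α κ c R + s = s + kepPeriod α κ c R by ring,
      orbAngle_add_kepPeriod h0 h2 hκ hc hR, zero_add]
    ring
  · intro t
    have hn : ‖kepOrbit α κ c R (t + s)‖ ≠ 0 :=
      norm_ne_zero_iff.2 ((isSolution_kepOrbit h0 h2 hκ hc hR).ne_zero _)
    have h1 := hxϑ t
    rw [norm_eq_of_eq_rotate hx, hx] at h1
    nth_rewrite 1 [kepOrbit_eq_norm_mul hR] at h1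
    have h3 : (‖kepOrbit α κ c R (t + s)‖ : ℂ) ≠ 0 := by exact_mod_cast hn
    rw [mul_left_comm] at h1
    have h4 := mul_left_cancel₀ h3 h1
    rw [← h4, ← Complex.exp_add]
    push_cast
    congr 1
    ring

theorem IsOfType.exists_eq_rotate {n k : ℕ} (h0 : 0 < α) (h2 : α < 2) (hκ : 0 < κ)
    (hx : IsOfType α κ n k x) :
    ∃ R c s φ : ℝ, 0 < R ∧ c ∈ Ioo 0 1 ∧ apsidal α c = 2 * π * (k / n) ∧
      ∀ t, x t = Complex.exp (φ * Complex.I) * kepOrbit α κ c R (t + s) := by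
  obtain ⟨H, L, hHL, hH, hL⟩ := hx.admissible
  obtain ⟨R, c, hR, hc, rfl, rfl⟩ := exists_params h0 h2 hκ hHL
  obtain ⟨s, φ, h⟩ := hx.isSolution.eq_rotate_kepOrbit h0 h2 hκ hc hR (hH 0) (hL 0)
  exact ⟨R, c, s, φ, hR, hc, (apsidalAngle_eq h0 h2 hκ hc hR h hx.apsidalAngle).symm, h⟩

theorem isOfType_kepOrbit {n k : ℕ} (h0 : 0 < α) (h2 : α < 2) (hκ : 0 < κ) (hc : c ∈ Ioo 0 1)
    (hR : 0 < R) (hΘ : apsidal α c = 2 * π * (k / n)) :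
    IsOfType α κ n k (kepOrbit α κ c R) where
  isSolution := isSolution_kepOrbit h0 h2 hκ hc hR
  admissible := ⟨_, _, mem_admissible h0 h2 hκ hc hR, energy_kepOrbit h0 h2 hκ hc hR,
    angularMomentum_kepOrbit h0 h2 hc hR⟩
  apsidalAngle := hΘ ▸ hasApsidalAngle_kepOrbit h0 h2 hκ hc hR

/-- For fixed c the frequency is proportional to R^(-(α+2)/2), so every positive value is attained;
this realises an arbitrary period. -/
theorem exists_kepFreq_eq {m : ℝ} (h0 : 0 < α) (hκ : 0 < κ) (hc : c ∈ Ioo 0 1) (hm : 0 < m) :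
    ∃ R, 0 < R ∧ kepFreq α κ c R = m := by
  have hc1 : 0 < 1 - c ^ 2 := by nlinarith [hc.1, hc.2]
  have hA : 0 < κ * (1 - c ^ 2) / m ^ 2 := by positivity
  refine ⟨(κ * (1 - c ^ 2) / m ^ 2) ^ (1 / (α + 2)), rpow_pos_of_pos hA _, ?_⟩
  rw [kepFreq, ← rpow_mul hA.le, one_div_mul_cancel (by linarith), rpow_one]
  rw [show κ * (1 - c ^ 2) / (κ * (1 - c ^ 2) / m ^ 2) = m ^ 2 by field_simp, sqrt_sq hm.le]

theorem kepFreq_injOn (h0 : 0 < α) (hκ : 0 < κ) (hc : c ∈ Ioo 0 1) :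
    InjOn (kepFreq α κ c) (Ioi 0) := by
  intro R₁ h₁ R₂ h₂ h
  have h₁ : 0 < R₁ := h₁
  have h₂ : 0 < R₂ := h₂
  have hc1 : 0 < 1 - c ^ 2 := by nlinarith [hc.1, hc.2]
  have h := congrArg (· ^ 2) h
  simp only [kepFreq_sq hκ hc h₁, kepFreq_sq hκ hc h₂] at h
  have p1 := rpow_pos_of_pos h₁ (α + 2)
  have p2 := rpow_pos_of_pos h₂ (α + 2)
  rw [div_eq_div_iff p1.ne' p2.ne'] at h
  have h := mul_left_cancel₀ (by positivity) h
  exact ((rpow_left_inj h₁.le h₂.le (by linarith)).1 h.symm)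

end

/-! ### Conclusion: the admissible ratios, existence and uniqueness -/

/-- The condition on the apsidal angle in both ranges of the exponent. -/
theorem mul_mem_Ioo_iff {α v : ℝ} (h1 : α ≠ 1) :
    (α - 1) * (2 * π * v) ∈ Ioo ((α - 1) * (2 * π / √(2 - α))) ((α - 1) * (2 * π / (2 - α))) ↔
      ((α < 1 ∧ v ∈ Ioo (1 / (2 - α)) (1 / √(2 - α))) ∨
        (1 < α ∧ v ∈ Ioo (1 / √(2 - α)) (1 / (2 - α)))) := by
  have hp := two_pi_pos
  have e1 : (α - 1) * (2 * π / √(2 - α)) = (α - 1) * (2 * π * (1 / √(2 - α))) := by ring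
  have e2 : (α - 1) * (2 * π / (2 - α)) = (α - 1) * (2 * π * (1 / (2 - α))) := by ring
  rw [e1, e2]
  simp only [mem_Ioo]
  rcases lt_or_gt_of_ne h1 with h | h
  · have h' : α - 1 < 0 := by linarith
    rw [mul_lt_mul_left_of_neg h', mul_lt_mul_left_of_neg h', mul_lt_mul_iff_right₀ hp,
      mul_lt_mul_iff_right₀ hp]
    simp [h, h.not_gt, and_comm]
  · have h' : 0 < α - 1 := by linarith
    rw [mul_lt_mul_iff_right₀ h', mul_lt_mul_iff_right₀ h', mul_lt_mul_iff_right₀ hp,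
      mul_lt_mul_iff_right₀ hp]
    simp [h, h.not_gt]

end HomKepler

theorem theorem5p2 (α κ : ℝ) (hα₀ : 0 < α) (hα₂ : α < 2) (hα₁ : α ≠ 1) (hκ : 0 < κ)
    (τ : ℝ) (hτ : 0 < τ) (n k : ℕ) (hn : 0 < n) (hk : 0 < k) (hnk : Nat.Coprime n k) :
    ((∃ x : ℝ → ℂ, HomKepler.IsOfType α κ n k x ∧ HomKepler.IsMinimalPeriod x τ) ↔
      ((α < 1 ∧ (k : ℝ) / (n : ℝ) ∈ Set.Ioo (1 / (2 - α)) (1 / Real.sqrt (2 - α))) ∨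
        (1 < α ∧ (k : ℝ) / (n : ℝ) ∈ Set.Ioo (1 / Real.sqrt (2 - α)) (1 / (2 - α))))) ∧
    (∀ x y : ℝ → ℂ,
      HomKepler.IsOfType α κ n k x → HomKepler.IsMinimalPeriod x τ →
      HomKepler.IsOfType α κ n k y → HomKepler.IsMinimalPeriod y τ →
      ∃ s φ : ℝ, ∀ t : ℝ, y t = Complex.exp (φ * Complex.I) * x (t + s)) := by
  refine ⟨⟨?_, fun h => ?_⟩, fun x y hx hxτ hy hyτ => ?_⟩
  · rintro ⟨x, hx, -⟩
    obtain ⟨R, c, s, φ, hR, hc, hΘ, -⟩ := hx.exists_eq_rotate hα₀ hα₂ hκ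
    rw [← HomKepler.mul_mem_Ioo_iff hα₁, ← hΘ]
    exact ⟨HomKepler.lt_mul_apsidal hα₀ hα₂ hα₁ hc, HomKepler.mul_apsidal_lt hα₀ hα₂ hα₁ hc⟩
  · rw [← HomKepler.mul_mem_Ioo_iff hα₁] at h
    obtain ⟨c, hc, hΘ⟩ := HomKepler.exists_apsidal_eq hα₀ hα₂ hα₁ h
    have hP := HomKepler.orbPeriod_pos hα₀ hα₂ hc
    have hn' : (0 : ℝ) < n := by exact_mod_cast hn
    -- This frequency makes n radial periods last exactly τ.
    obtain ⟨R, hR, hm⟩ := HomKepler.exists_kepFreq_eq (m := n * HomKepler.orbPeriod α c / τ)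
      hα₀ hκ hc (by positivity)
    refine ⟨_, HomKepler.isOfType_kepOrbit hα₀ hα₂ hκ hc hR hΘ, ?_⟩
    have := HomKepler.isMinimalPeriod_kepOrbit hα₀ hα₂ hκ hc hR hn hnk hΘ
    rwa [HomKepler.kepPeriod, hm, show n * (HomKepler.orbPeriod α c /
      (n * HomKepler.orbPeriod α c / τ)) = τ by field_simp] at this
  · obtain ⟨R₁, c₁, s₁, φ₁, hR₁, hc₁, hΘ₁, hx'⟩ := hx.exists_eq_rotate hα₀ hα₂ hκ
    obtain ⟨R₂, c₂, s₂, φ₂, hR₂, hc₂, hΘ₂, hy'⟩ := hy.exists_eq_rotate hα₀ hα₂ hκ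
    -- The common apsidal angle forces the same c; below, the common minimal period forces the same
    -- R, so both solutions are moved copies of one model orbit.
    obtain rfl := HomKepler.apsidal_injOn hα₀ hα₂ hα₁ hc₁ hc₂ (hΘ₁.trans hΘ₂.symm)
    have hP := HomKepler.orbPeriod_pos hα₀ hα₂ hc₁
    have hn' : (0 : ℝ) < n := by exact_mod_cast hn
    have e₁ := (HomKepler.isMinimalPeriod_of_eq_rotate hx' hxτ).unique
      (HomKepler.isMinimalPeriod_kepOrbit hα₀ hα₂ hκ hc₁ hR₁ hn hnk hΘ₁)
    have e₂ := (HomKepler.isMinimalPeriod_of_eq_rotate hy' hyτ).unique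
      (HomKepler.isMinimalPeriod_kepOrbit hα₀ hα₂ hκ hc₁ hR₂ hn hnk hΘ₁)
    have hμ : HomKepler.kepFreq α κ c₁ R₁ = HomKepler.kepFreq α κ c₁ R₂ := by
      have e := mul_left_cancel₀ hn'.ne' (e₁.symm.trans e₂)
      have p₁ := HomKepler.kepFreq_pos (α := α) hκ hc₁ hR₁
      have p₂ := HomKepler.kepFreq_pos (α := α) hκ hc₁ hR₂
      rw [HomKepler.kepPeriod, HomKepler.kepPeriod, div_eq_div_iff p₁.ne' p₂.ne'] at e
      exact (mul_left_cancel₀ hP.ne' e).symm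
    obtain rfl := HomKepler.kepFreq_injOn hα₀ hκ hc₁ hR₁ hR₂ hμ
    refine ⟨s₂ - s₁, φ₂ - φ₁, fun t => ?_⟩
    rw [hy', hx', ← mul_assoc, ← Complex.exp_add, show t + (s₂ - s₁) + s₁ = t + s₂ by ring]
    push_cast
    congr 2
    ring
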